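/- Let $(a_k)_{k\ge 0}$, $(b_k)_{k\ge 0}$ be real sequences with $a_k>0$ for all $k$. Let $\mathcal D\subset\ell^2(\mathbb N)$ (complex sequences, inner product $\langle\cdot,\cdot\rangle$ linear in the first variable) be the space of finite linear combinations of the standard basis vectors $e_k$, $k\ge 0$, and let the Jacobi operator $J\colon\mathcal D\to\ell^2(\mathbb N)$ be the linear map with $$Je_0=a_0e_1+b_0e_0,\qquad Je_k=a_ke_{k+1}+b_ke_k+a_{k-1}e_{k-1}\quad(k\ge 1),$$ with adjoint $(J^*,\mathcal D^*)$. Let the polynomials $p_n$ be given by $p_0=1$, $x\,p_0=a_0p_1+b_0p_0$ and $x\,p_k=a_kp_{k+1}+b_kp_k+a_{k-1}p_{k-1}$ for $k\ge 1$. The deficiency indices are $n_\pm=\dim\{v\in\mathcal D^*: J^*v=\pm i\,v\}$. A resolution of the identity is a projection valued Borel measure $E$ on $\mathbb R$. It is a spectral decomposition of a self-adjoint operator $T$ if $T=\int_{\mathbb R}t\,dE(t)$, that is, the domain of $T$ is $\{u:\int t^2\,d\langle E(t)u,u\rangle<\infty\}$ and $\langle Tu,v\rangle=\int t\,d\langle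 E(t)u,v\rangle$ for all $u$ in the domain of $T$ and all $v\in\ell^2(\mathbb N)$. An orthogonality measure for $(p_n)$ is a positive Borel measure $\mu$ on $\mathbb R$ with finite moments of all orders such that $\int p_m p_n\,d\mu=\delta_{m,n}$ for all $m,n\ge 0$. (i) The deficiency indices $(n_+,n_-)$ of $(J,\mathcal D)$ are $(0,0)$ or $(1,1)$. (ii) If $(n_+,n_-)=(0,0)$, then $(J,\mathcal D)$ is essentially self-adjoint, i.e. its closure is self-adjoint, and this closure equals $(J^*,\mathcal D^*)$. The operator $(J^*,\mathcal D^*)$ has a spectral decomposition, and if $E$ is a spectral decomposition of $(J^*,\mathcal D^*)$, then $\mu(B)=\langle E(B)e_0,e_0\rangle$ ($B\subset\mathbb R$ Borel) is an orthogonality measure for $(p_n)$. (iii) If $(n_+,n_-)=(1,1)$, then there are self-adjoint operators $T$ with $J\subset T\subset J^*$. Every such $T$ has a spectral decomposition, and if $E$ is a spectral decomposition of such a $T$, then $\mu(B)=\langle E(B)e_0,e_0\rangle$ ($B\subset\mathbb R$ Borel) is an orthogonality measure for $(p_n)$. -/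

import Mathlib

open MeasureTheory Polynomial
open scoped lp

noncomputable section

/-! ### Resolutions of the identity and spectral decompositions -/

section Spectral

variable {H : Type*} [NormedAddCommGroup H] [InnerProductSpace ℂ H] [CompleteSpace H]

/-- A resolution of the identity on the Hilbert space `H`: a projection valued Borel measure on `ℝ`.
Only the values on Borel sets carry information; as for Mathlib's vector measures the value on
the other sets is `0` by convention. Mathlib's inner product is linear in the second
variable, so `inner ℂ v (E A u)` is `⟨E(A)u, v⟩` for an inner product linear in the first one. -/
structure ResolutionOfIdentity (H : Type*) [NormedAddCommGroup H] [InnerProductSpace ℂ H]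
    [CompleteSpace H] where
  /-- The projection `E(A)`. -/
  proj : Set ℝ → H →L[ℂ] H
  isStarProjection : ∀ A, MeasurableSet A → IsStarProjection (proj A)
  inter : ∀ A B, MeasurableSet A → MeasurableSet B → proj (A ∩ B) = proj A * proj B
  empty : proj ∅ = 0
  univ : proj Set.univ = 1
  union : ∀ A B, MeasurableSet A → MeasurableSet B → Disjoint A B →
    proj (A ∪ B) = proj A + proj B
  /-- Countable additivity of `A ↦ ⟨E(A)u, v⟩`. -/
  hasSum : ∀ (u v : H) (A : ℕ → Set ℝ), (∀ n, MeasurableSet (A n)) →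
    Pairwise (Function.onFun Disjoint A) →
    HasSum (fun n => inner ℂ v (proj (A n) u)) (inner ℂ v (proj (⋃ n, A n) u))
  not_measurable : ∀ A, ¬ MeasurableSet A → proj A = 0

namespace ResolutionOfIdentity

variable (E : ResolutionOfIdentity H)

/-- The complex Borel measure `E_{u,v}(A) = ⟨E(A)u, v⟩`. -/
def complexMeasure (u v : H) : ComplexMeasure ℝ where
  measureOf' A := inner ℂ v (E.proj A u)
  empty' := by simp [E.empty]
  not_measurable' A hA := by simp [E.not_measurable A hA]
  m_iUnion' A hA hd := E.hasSum u v A hA hd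

theorem inner_proj_self (u : H) {A : Set ℝ} (hA : MeasurableSet A) :
    inner ℂ u (E.proj A u) = ((‖E.proj A u‖ ^ 2 : ℝ) : ℂ) := by
  have h := E.isStarProjection A hA
  have h1 : E.proj A u = E.proj A (E.proj A u) := by
    conv_lhs => rw [← h.isIdempotentElem.eq]
    rfl
  have h2 : ContinuousLinearMap.adjoint (E.proj A) = E.proj A := h.isSelfAdjoint
  conv_lhs => rw [h1, ← ContinuousLinearMap.adjoint_inner_left, h2]
  rw [inner_self_eq_norm_sq_to_K]
  norm_cast

/-- The positive Borel measure `B ↦ ⟨E(B)u, u⟩`. -/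
def measure (u : H) : Measure ℝ :=
  Measure.ofMeasurable (fun A _ => ENNReal.ofReal (inner ℂ u (E.proj A u)).re)
    (by simp [E.empty])
    (by
      intro A hA hd
      have h := Complex.hasSum_re (E.hasSum u u A hA hd)
      have hn : ∀ n, 0 ≤ (inner ℂ u (E.proj (A n) u)).re := fun n => by
        rw [E.inner_proj_self u (hA n), Complex.ofReal_re]; positivity
      rw [← h.tsum_eq, ENNReal.ofReal_tsum_of_nonneg hn h.summable])

theorem measure_apply (u : H) {B : Set ℝ} (hB : MeasurableSet B) :
    E.measure u B = ENNReal.ofReal (inner ℂ u (E.proj B u)).re :=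
  Measure.ofMeasurable_apply B hB

/-- `measure` is what it should be: `μ(B) = ⟨E(B)u, u⟩` as complex numbers. -/
theorem coe_measure_real (u : H) {B : Set ℝ} (hB : MeasurableSet B) :
    (((E.measure u).real B : ℝ) : ℂ) = inner ℂ u (E.proj B u) := by
  rw [Measure.real, E.measure_apply u hB, E.inner_proj_self u hB, Complex.ofReal_re,
    ENNReal.toReal_ofReal (by positivity)]

end ResolutionOfIdentity

/-- `E` is the spectral decomposition of `T`, that is `T = ∫ t dE(t)`: the domain of `T` is
`{u | ∫ t² dE_{u,u}(t) < ∞}`, and `⟨Tu, v⟩ = ∫ t dE_{u,v}(t)` for `u` in the domain and every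
`v`, the integral being taken with respect to a complex measure and absolutely convergent. -/
def IsSpectralDecomposition (T : H →ₗ.[ℂ] H) (E : ResolutionOfIdentity H) : Prop :=
  (∀ u : H, u ∈ T.domain ↔ Integrable (fun t : ℝ => t ^ 2) (E.measure u)) ∧
  ∀ (u : T.domain) (v : H),
    (E.complexMeasure (u : H) v).Integrable (fun t : ℝ => t) ∧
    inner ℂ v (T u) =
      (E.complexMeasure (u : H) v).integral (fun t : ℝ => t) (ContinuousLinearMap.lsmul ℝ ℝ)

/-! ### Deficiency indices and essential self-adjointness -/

/-- `N_z = {v ∈ D(T*) | T* v = z v}`. -/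
def deficiencySpace (T : H →ₗ.[ℂ] H) (z : ℂ) : Submodule ℂ H :=
  (LinearMap.ker (T.adjoint.toFun - z • T.adjoint.domain.subtype)).map T.adjoint.domain.subtype

/-- The deficiency indices `(n₊, n₋) = (dim N_i, dim N_{-i})`, as cardinals. -/
def deficiencyIndices (T : H →ₗ.[ℂ] H) : Cardinal × Cardinal :=
  (Module.rank ℂ (deficiencySpace T Complex.I), Module.rank ℂ (deficiencySpace T (-Complex.I)))

/-- An operator is essentially self-adjoint if its closure is self-adjoint. -/
def IsEssentiallySelfAdjoint (T : H →ₗ.[ℂ] H) : Prop := IsSelfAdjoint T.closure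

end Spectral

/-! ### The Jacobi operator on `ℓ²(ℕ)` -/

/-- The standard orthonormal basis vector `e_k` of `ℓ²(ℕ)`. -/
def jacobiBasis (k : ℕ) : ℓ²(ℕ, ℂ) := lp.single 2 k (1 : ℂ)

theorem orthonormal_jacobiBasis : Orthonormal ℂ jacobiBasis := by
  rw [orthonormal_iff_ite]
  intro i j
  simp only [jacobiBasis, lp.inner_single_left, lp.single_apply, Pi.single_apply]
  split_ifs <;> simp_all

/-- The value `J e_k` of the Jacobi operator. -/
def jacobiImage (a b : ℕ → ℝ) : ℕ → ℓ²(ℕ, ℂ)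
  | 0 => (a 0 : ℂ) • jacobiBasis 1 + (b 0 : ℂ) • jacobiBasis 0
  | k + 1 => (a (k + 1) : ℂ) • jacobiBasis (k + 2) + (b (k + 1) : ℂ) • jacobiBasis (k + 1)
      + (a k : ℂ) • jacobiBasis k

/-- The Jacobi operator `(J, D)`: its domain `D` is the space of finite linear combinations of the
`e_k`, and it is the linear map with the prescribed values `J e_k`. -/
def jacobiOperator (a b : ℕ → ℝ) : ℓ²(ℕ, ℂ) →ₗ.[ℂ] ℓ²(ℕ, ℂ) where
  domain := Submodule.span ℂ (Set.range jacobiBasis)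
  toFun := (Module.Basis.span orthonormal_jacobiBasis.linearIndependent).constr ℂ (jacobiImage a b)

theorem jacobiBasis_mem_domain (a b : ℕ → ℝ) (k : ℕ) :
    jacobiBasis k ∈ (jacobiOperator a b).domain :=
  Submodule.subset_span ⟨k, rfl⟩

theorem jacobiOperator_apply_basis (a b : ℕ → ℝ) (k : ℕ) :
    jacobiOperator a b ⟨jacobiBasis k, jacobiBasis_mem_domain a b k⟩ = jacobiImage a b k := by
  have h : Module.Basis.span orthonormal_jacobiBasis.linearIndependent k =
      ⟨jacobiBasis k, Submodule.subset_span ⟨k, rfl⟩⟩ :=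
    Subtype.ext (by simp [Module.Basis.span_apply])
  have h2 := Module.Basis.constr_basis
    (Module.Basis.span orthonormal_jacobiBasis.linearIndependent) ℂ (jacobiImage a b) k
  rw [h] at h2
  exact h2

/-! ### The polynomials and their orthogonality measures -/

/-- The polynomials with `p_0 = 1` generated by `x p_0 = a_0 p_1 + b_0 p_0` and
`x p_k = a_k p_{k+1} + b_k p_k + a_{k-1} p_{k-1}` for `k ≥ 1`. -/
def jacobiPolynomial (a b : ℕ → ℝ) : ℕ → ℝ[X]
  | 0 => 1
  | 1 => C (a 0)⁻¹ * (X - C (b 0))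
  | k + 2 => C (a (k + 1))⁻¹ *
      ((X - C (b (k + 1))) * jacobiPolynomial a b (k + 1) - C (a k) * jacobiPolynomial a b k)

theorem X_mul_jacobiPolynomial_zero (a b : ℕ → ℝ) (ha : ∀ k, 0 < a k) :
    X * jacobiPolynomial a b 0 =
      C (a 0) * jacobiPolynomial a b 1 + C (b 0) * jacobiPolynomial a b 0 := by
  simp only [jacobiPolynomial]
  rw [← mul_assoc, ← C_mul, mul_inv_cancel₀ (ha 0).ne', C_1]
  ring

theorem X_mul_jacobiPolynomial_succ (a b : ℕ → ℝ) (ha : ∀ k, 0 < a k) (k : ℕ) :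
    X * jacobiPolynomial a b (k + 1) =
      C (a (k + 1)) * jacobiPolynomial a b (k + 2) + C (b (k + 1)) * jacobiPolynomial a b (k + 1)
        + C (a k) * jacobiPolynomial a b k := by
  rw [jacobiPolynomial.eq_3 a b k, ← mul_assoc, ← C_mul, mul_inv_cancel₀ (ha (k + 1)).ne', C_1]
  ring

/-- `μ` is an orthogonality measure for the real polynomials `p_n`: a positive Borel measure on `ℝ`
with finite moments of all orders and `∫ p_m p_n dμ = δ_{m,n}`. -/
def IsOrthogonalityMeasure (μ : Measure ℝ) (p : ℕ → ℝ[X]) : Prop :=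
  (∀ k : ℕ, Integrable (fun x : ℝ => x ^ k) μ) ∧
  ∀ m n : ℕ, ∫ x, (p m).eval x * (p n).eval x ∂μ = if m = n then 1 else 0

end

/-! The adjoint J* acts by the Jacobi matrix on every v in ℓ² with matrix image in ℓ². So J*v = zv
is the three-term recurrence, which v(0) determines because a_k ≠ 0, and the deficiency spaces have
dimension at most 1. The matrix is real, so complex conjugation exchanges the spaces for i and -i,
and the two indices agree. If both vanish, the basic criterion makes the closure self-adjoint
(`isSelfAdjoint_closure`).

If they equal 1, the boundary form of J* is a limit of Wronskians (`tendsto_wronskian`). Each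
Wronskian is a 2×2 determinant, so the form inherits the Plücker relation (`boundaryForm_pluecker`).
Hence one boundary condition B(u, ψ) = 0 with a real, nondegenerate ψ cuts out a self-adjoint
restriction of J*. Adding a deficiency vector to its conjugate gives such a ψ.

The spectral theorem is reduced to the bounded normal resolvent R = (T + i)⁻¹. The Riesz
representation theorem turns its continuous functional calculus into measures on the spectrum of R,
then into projections. These are transported to ℝ by z = 1/(t + i)
(`exists_isSpectralDecomposition`).

Orthogonality holds because e_n and p_n obey the same recurrence, so that e_n = p_n(T)e_0. In terms
of measures, ⟨E(·)e_n, e_m⟩ has density p_n p_m with respect to μ, and its total mass is ⟨e_n, e_m⟩.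
No functional calculus for a given E is needed, only the rule that T multiplies densities by t
(`HasDensity.apply`). -/

set_option linter.unusedSectionVars false

noncomputable section

/-! ### Integration against a complex measure with a density -/

namespace MeasureTheory.Measure

variable {X : Type*} [MeasurableSpace X] {μ : Measure X} {d : X → ℂ} {f : X → ℝ}

theorem integrable_withDensityᵥ_iff (hd : Integrable d μ) (hf : Measurable f) :
    (μ.withDensityᵥ d).Integrable f ↔ Integrable (fun x => f x • d x) μ := by
  rw [VectorMeasure.Integrable, Measure.variation_withDensityᵥ hd,
    integrable_withDensity_iff_integrable_smul₀' hd.1.enorm (by simp),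
    ← integrable_norm_iff (f := fun x => f x • d x) (hf.aestronglyMeasurable.smul hd.1),
    ← integrable_norm_iff (f := fun x => ‖d x‖ₑ.toReal • f x)
      (hd.1.enorm.ennreal_toReal.aestronglyMeasurable.smul hf.aestronglyMeasurable)]
  simp [mul_comm]

/-- The variation is |d|μ, so it controls f and g only where d ≠ 0; elsewhere both products vanish.
-/
theorem smul_ae_eq_of_withDensityᵥ (hd : Integrable d μ) {f g : X → ℝ}
    (h : f =ᵐ[(μ.withDensityᵥ d).variation] g) :
    (fun x => f x • d x) =ᵐ[μ] fun x => g x • d x := by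
  rw [Measure.variation_withDensityᵥ hd, Filter.EventuallyEq,
    ae_withDensity_iff' hd.1.enorm] at h
  filter_upwards [h] with x hx
  by_cases h0 : d x = 0
  · simp [h0]
  · rw [hx (by simpa using h0)]

theorem integrable_smul_of_withDensityᵥ (hd : Integrable d μ)
    (h : (μ.withDensityᵥ d).Integrable f) : Integrable (fun x => f x • d x) μ := by
  have hae := h.1.ae_eq_mk
  refine Integrable.congr ?_ (smul_ae_eq_of_withDensityᵥ hd hae.symm)
  rw [← integrable_withDensityᵥ_iff hd h.1.stronglyMeasurable_mk.measurable]
  exact Integrable.congr h hae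

theorem lintegral_variation_withDensityᵥ (hd : Integrable d μ)
    (h : (μ.withDensityᵥ d).Integrable f) :
    ∫⁻ x, ‖f x • d x‖ₑ ∂μ = ∫⁻ x, ‖f x‖ₑ ∂(μ.withDensityᵥ d).variation := by
  rw [Measure.variation_withDensityᵥ hd, lintegral_withDensity_eq_lintegral_mul₀' hd.1.enorm]
  · simp only [enorm_smul, Pi.mul_apply, mul_comm]
  · rw [← Measure.variation_withDensityᵥ hd]
    exact h.1.enorm

/-- The integral with respect to a complex measure with a density. -/
theorem integral_withDensityᵥ (hd : Integrable d μ) (h : (μ.withDensityᵥ d).Integrable f) :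
    (μ.withDensityᵥ d).integral f (ContinuousLinearMap.lsmul ℝ ℝ) = ∫ x, f x • d x ∂μ := by
  refine Integrable.induction (P := fun f : X → ℝ =>
    (μ.withDensityᵥ d).integral f (ContinuousLinearMap.lsmul ℝ ℝ) = ∫ x, f x • d x ∂μ)
    ?_ ?_ ?_ ?_ h
  · intro c s hs hc
    have : IsFiniteMeasure ((μ.withDensityᵥ d).variation.restrict s) := ⟨by simpa⟩
    rw [VectorMeasure.integral_indicator_const _ hs, withDensityᵥ_apply hd hs,
      ← integral_indicator hs, ContinuousLinearMap.lsmul_apply, ← integral_smul]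
    congr 1 with x
    by_cases hx : x ∈ s <;> simp [hx]
  · intro f g _ hf hg hfi hgi
    rw [VectorMeasure.integral_add hf hg, hfi, hgi,
      ← integral_add (integrable_smul_of_withDensityᵥ hd hf)
      (integrable_smul_of_withDensityᵥ hd hg)]
    simp [add_mul]
  · refine isClosed_eq VectorMeasure.continuous_integral ?_
    -- The L¹ distance for the variation is ∫ |f - g| |d| dμ, so the right-hand side is 1-Lipschitz
    -- in f.
    refine (LipschitzWith.of_dist_le_mul (K := 1) fun f g => ?_).continuous
    have hf := integrable_smul_of_withDensityᵥ hd (L1.integrable_coeFn f)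
    have hg := integrable_smul_of_withDensityᵥ hd (L1.integrable_coeFn g)
    rw [dist_eq_norm, ← integral_sub hf hg, NNReal.coe_one, one_mul, L1.dist_eq_integral_dist]
    refine (norm_integral_le_integral_norm _).trans_eq ?_
    have hfg : (μ.withDensityᵥ d).Integrable fun x => f x - g x :=
      (L1.integrable_coeFn f).sub (L1.integrable_coeFn g)
    have h1 := lintegral_variation_withDensityᵥ hd hfg
    have h2 := integral_norm_eq_lintegral_enorm (integrable_smul_of_withDensityᵥ hd hfg).1
    have h3 := integral_norm_eq_lintegral_enorm hfg.1
    simp only [dist_eq_norm]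
    rw [h3, ← h1, ← h2]
    simp only [sub_smul]
  · intro f g hfg _ hf
    rw [← VectorMeasure.integral_congr_ae hfg, hf,
      integral_congr_ae (smul_ae_eq_of_withDensityᵥ hd hfg)]

theorem restrict_withDensityᵥ (hd : Integrable d μ) {A : Set X} (hA : MeasurableSet A) :
    (μ.withDensityᵥ d).restrict A = μ.withDensityᵥ (A.indicator d) := by
  ext B hB
  rw [VectorMeasure.restrict_apply _ hA hB, withDensityᵥ_apply hd (hB.inter hA),
    withDensityᵥ_apply (hd.indicator hA) hB, setIntegral_indicator hA]

end MeasureTheory.Measure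

/-! ### Symmetric operators and the basic criterion of self-adjointness -/

namespace LinearPMap

open scoped InnerProductSpace ComplexConjugate

variable {H : Type*} [NormedAddCommGroup H] [InnerProductSpace ℂ H] [CompleteSpace H]
  {S T : H →ₗ.[ℂ] H}

omit [CompleteSpace H] in
theorem apply_congr {u v : S.domain} (h : (u : H) = v) : S u = S v := by
  rw [Subtype.ext h]

/-- A value of the adjoint, from the defining relation. -/
theorem mem_adjoint_of_forall_inner (hS : Dense (S.domain : Set H)) {v w : H}
    (h : ∀ x : S.domain, ⟪w, (x : H)⟫_ℂ = ⟪v, S x⟫_ℂ) :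
    ∃ hv : v ∈ S.adjoint.domain, S.adjoint ⟨v, hv⟩ = w :=
  ⟨mem_adjoint_domain_of_exists v ⟨w, h⟩, adjoint_apply_eq hS _ h⟩

theorem inner_adjoint_left (hS : Dense (S.domain : Set H)) (v : S.adjoint.domain)
    (x : S.domain) : ⟪S.adjoint v, (x : H)⟫_ℂ = ⟪(v : H), S x⟫_ℂ :=
  adjoint_isFormalAdjoint hS v x

/-- Symmetry of an operator contained in its adjoint. -/
theorem inner_symm_of_le_adjoint (hS : Dense (S.domain : Set H)) (h : S ≤ S.adjoint)
    (x y : S.domain) : ⟪S x, (y : H)⟫_ℂ = ⟪(x : H), S y⟫_ℂ := by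
  rw [h.2 (x := x) (y := ⟨x, h.1 x.2⟩) rfl, inner_adjoint_left hS]

/-- Symmetry makes ⟨Sx, x⟩ real, so the cross term has no real part when ε = ±i. This identity gives
injectivity, closed range and the resolvent bound. -/
theorem norm_sq_add_smul (hS : Dense (S.domain : Set H)) (h : S ≤ S.adjoint) {ε : ℂ}
    (hε : ε = Complex.I ∨ ε = -Complex.I) (x : S.domain) :
    ‖S x + ε • (x : H)‖ ^ 2 = ‖S x‖ ^ 2 + ‖(x : H)‖ ^ 2 := by
  have hsym := inner_symm_of_le_adjoint hS h x x
  have him : (⟪S x, (x : H)⟫_ℂ).im = 0 := by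
    rw [← Complex.conj_eq_iff_im, inner_conj_symm, hsym]
  rw [norm_add_sq (𝕜 := ℂ), inner_smul_right]
  rcases hε with rfl | rfl <;> simp [him, norm_smul]

/-- The graph of S is complete, and the norm identity makes (x, Sx) ↦ Sx + εx antilipschitz on it.
-/
theorem isClosed_range_add_smul (hS : Dense (S.domain : Set H)) (h : S ≤ S.adjoint)
    (hc : S.IsClosed) {ε : ℂ} (hε : ε = Complex.I ∨ ε = -Complex.I) :
    _root_.IsClosed {w : H | ∃ x : S.domain, S x + ε • (x : H) = w} := by
  have : CompleteSpace S.graph := (show _root_.IsClosed (S.graph : Set (H × H)) from hc).completeSpace_coe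
  let f : S.graph →L[ℂ] H := (ContinuousLinearMap.snd ℂ H H + ε • ContinuousLinearMap.fst ℂ H H).comp
    S.graph.subtypeL
  have hf : AntilipschitzWith 1 f := by
    refine AddMonoidHomClass.antilipschitz_of_bound f fun g => ?_
    obtain ⟨g, hg⟩ := g
    obtain ⟨x, hx1, hx2⟩ := (mem_graph_iff S).1 hg
    have := norm_sq_add_smul hS h hε x
    have hfg : f ⟨g, hg⟩ = S x + ε • (x : H) := by simp [f, hx1, hx2]
    rw [hfg, NNReal.coe_one, one_mul]
    change ‖g‖ ≤ _
    rw [Prod.norm_def, ← hx1, ← hx2]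
    refine max_le ?_ ?_ <;> refine (sq_le_sq₀ (norm_nonneg _) (norm_nonneg _)).1 ?_ <;> rw [this] <;> simp
  convert hf.isClosed_range f.uniformContinuous
  ext w
  simp only [Set.mem_ofPred_eq, Set.mem_range]
  constructor
  · rintro ⟨x, rfl⟩
    exact ⟨⟨(x, S x), mem_graph S x⟩, by simp [f]⟩
  · rintro ⟨⟨g, hg⟩, rfl⟩
    obtain ⟨x, hx1, hx2⟩ := (mem_graph_iff S).1 hg
    exact ⟨x, by simp [f, hx1, hx2]⟩

/-- A closed symmetric operator `S` such that `S† - ε` is injective has `S + ε` surjective. -/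
theorem exists_add_smul_eq (hS : Dense (S.domain : Set H)) (h : S ≤ S.adjoint)
    (hc : S.IsClosed) {ε : ℂ} (hε : ε = Complex.I ∨ ε = -Complex.I)
    (hker : ∀ v : S.adjoint.domain, S.adjoint v = ε • (v : H) → (v : H) = 0) (w : H) :
    ∃ x : S.domain, S x + ε • (x : H) = w := by
  let K : Submodule ℂ H := LinearMap.range (S.toFun + ε • S.domain.subtype)
  have hK : (K : Set H) = {w : H | ∃ x : S.domain, S x + ε • (x : H) = w} := by
    ext w; simp [K]
  have hKc : _root_.IsClosed (K : Set H) := hK ▸ isClosed_range_add_smul hS h hc hε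
  have : CompleteSpace K := hKc.completeSpace_coe
  suffices K = ⊤ by
    have hw : w ∈ (K : Set H) := by rw [this]; trivial
    rwa [hK] at hw
  rw [← Submodule.orthogonal_eq_bot_iff, Submodule.eq_bot_iff]
  intro v hv
  have hconj : conj ε = -ε := by rcases hε with rfl | rfl <;> simp
  -- A vector orthogonal to the range of S + ε is an eigenvector of S† for the conjugate of -ε,
  -- which is ε.
  obtain ⟨hv1, hv2⟩ := mem_adjoint_of_forall_inner hS (v := v) (w := ε • v) fun x => by
    have := (Submodule.mem_orthogonal' K v).1 hv (S x + ε • (x : H)) ⟨x, rfl⟩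
    rw [inner_add_right, inner_smul_right] at this
    rw [inner_smul_left, hconj]
    linear_combination -this
  exact hker ⟨v, hv1⟩ hv2

/-- The basic criterion of self-adjointness. -/
theorem adjoint_eq_of_injective (hS : Dense (S.domain : Set H)) (h : S ≤ S.adjoint)
    (hc : S.IsClosed)
    (hker : ∀ v : S.adjoint.domain, S.adjoint v = Complex.I • (v : H) → (v : H) = 0)
    (hker' : ∀ v : S.adjoint.domain, S.adjoint v = (-Complex.I) • (v : H) → (v : H) = 0) :
    S.adjoint = S := by
  refine (eq_of_le_of_domain_eq h (le_antisymm h.1 fun v hv => ?_)).symm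
  -- With Sx + ix = S†v + iv, the difference v - x satisfies S†(v - x) = -i(v - x), so it vanishes
  -- and v lies in the domain of S.
  obtain ⟨x, hx⟩ := exists_add_smul_eq hS h hc (Or.inl rfl) hker
    (S.adjoint ⟨v, hv⟩ + Complex.I • v)
  have hxv : v - x = 0 := by
    refine hker' ⟨v - x, sub_mem hv (h.1 x.2)⟩ ?_
    have h1 := S.adjoint.map_sub ⟨v, hv⟩ ⟨x, h.1 x.2⟩
    have h2 : S x = S.adjoint ⟨x, h.1 x.2⟩ := h.2 rfl
    have h3 : (⟨v, hv⟩ : S.adjoint.domain) - ⟨x, h.1 x.2⟩ = ⟨v - x, sub_mem hv (h.1 x.2)⟩ := rfl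
    rw [h3, ← h2] at h1
    have h4 : S.adjoint ⟨v, hv⟩ = S x + Complex.I • (x : H) - Complex.I • v := by
      rw [hx]; simp
    rw [h1, h4]
    change _ = -Complex.I • (v - (x : H))
    module
  rw [sub_eq_zero.1 hxv]
  exact x.2

/-! ### The resolvent of a self-adjoint operator -/

section Resolvent

variable (hT : IsSelfAdjoint T)
include hT

theorem inner_symm_of_isSelfAdjoint (x y : T.domain) :
    ⟪T x, (y : H)⟫_ℂ = ⟪(x : H), T y⟫_ℂ :=
  inner_symm_of_le_adjoint hT.dense_domain (isSelfAdjoint_def.1 hT).ge x y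

theorem eq_zero_of_isSelfAdjoint {ε : ℂ} (hε : ε = Complex.I ∨ ε = -Complex.I)
    (x : T.domain) (hx : T x + ε • (x : H) = 0) : (x : H) = 0 := by
  have := norm_sq_add_smul hT.dense_domain (isSelfAdjoint_def.1 hT).ge hε x
  rw [hx] at this
  have h2 : ‖(x : H)‖ ^ 2 = 0 := by nlinarith [sq_nonneg ‖T x‖, sq_nonneg ‖(x : H)‖, norm_zero (E := H)]
  simpa using h2

theorem existsUnique_add_smul_eq {ε : ℂ} (hε : ε = Complex.I ∨ ε = -Complex.I) (w : H) :
    ∃! x : T.domain, T x + ε • (x : H) = w := by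
  have hle := (isSelfAdjoint_def.1 hT).ge
  refine existsUnique_of_exists_of_unique ?_ fun x y hx hy => ?_
  · refine exists_add_smul_eq hT.dense_domain hle hT.isClosed hε ?_ w
    intro v hv
    have hle' : T.adjoint ≤ T := (isSelfAdjoint_def.1 hT).le
    refine eq_zero_of_isSelfAdjoint hT (ε := -ε) ?_ ⟨v, hle'.1 v.2⟩ ?_
    · rcases hε with rfl | rfl <;> simp
    · rw [← hle'.2 (x := v) rfl, hv]; simp
  · have := eq_zero_of_isSelfAdjoint hT hε (x - y) (by
      rw [T.map_sub, Submodule.coe_sub, smul_sub, sub_add_sub_comm, hx, hy, sub_self])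
    exact Subtype.ext (sub_eq_zero.1 this)

theorem exists_resolvent {ε : ℂ} (hε : ε = Complex.I ∨ ε = -Complex.I) :
    ∃ R : H →L[ℂ] H, ∀ w, ∃ h : R w ∈ T.domain, T ⟨R w, h⟩ + ε • R w = w := by
  choose r hr hu using existsUnique_add_smul_eq hT hε
  refine ⟨LinearMap.mkContinuous
    { toFun := fun w => (r w : H)
      map_add' := fun x y => ?_
      map_smul' := fun c x => ?_ } 1 fun w => ?_, fun w => ⟨(r w).2, hr w⟩⟩
  · rw [← hu (x + y) (r x + r y) ?_]
    · rfl
    · beta_reduce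
      rw [T.map_add, Submodule.coe_add]
      nth_rw 3 [← hr x]; nth_rw 3 [← hr y]
      module
  · rw [← hu (c • x) (c • r x) ?_]
    · rfl
    · beta_reduce
      rw [T.map_smul, Submodule.coe_smul]
      nth_rw 3 [← hr x]
      module
  · change ‖(r w : H)‖ ≤ _
    rw [one_mul]
    have := norm_sq_add_smul hT.dense_domain (isSelfAdjoint_def.1 hT).ge hε (r w)
    rw [hr w] at this
    exact (sq_le_sq₀ (norm_nonneg _) (norm_nonneg _)).1 (by rw [this]; simp)

/-- The resolvent `R = (T + i)⁻¹` of a self-adjoint operator. -/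
def resolventI : H →L[ℂ] H := (exists_resolvent hT (Or.inl rfl)).choose

theorem resolventI_mem (w : H) : resolventI hT w ∈ T.domain :=
  ((exists_resolvent hT (Or.inl rfl)).choose_spec w).1

theorem apply_resolventI (w : H) :
    T ⟨resolventI hT w, resolventI_mem hT w⟩ + Complex.I • resolventI hT w = w :=
  ((exists_resolvent hT (Or.inl rfl)).choose_spec w).2

theorem resolventI_apply (x : T.domain) : resolventI hT (T x + Complex.I • (x : H)) = x :=
  congrArg Subtype.val ((existsUnique_add_smul_eq hT (Or.inl rfl) _).unique
    (apply_resolventI hT (T x + Complex.I • (x : H))) (rfl : _ = T x + Complex.I • (x : H)))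

theorem resolventI_injective : Function.Injective (resolventI hT) := by
  refine (injective_iff_map_eq_zero _).2 fun w hw => ?_
  rw [← apply_resolventI hT w, apply_congr (v := 0) hw, T.map_zero, hw]
  simp

/-- The adjoint of (T + i)⁻¹ is (T - i)⁻¹: write y = (T - i)Qy and x = (T + i)Rx, and move T across
by symmetry. -/
theorem star_resolventI :
    ∀ w, ∃ h : star (resolventI hT) w ∈ T.domain,
      T ⟨star (resolventI hT) w, h⟩ + (-Complex.I) • star (resolventI hT) w = w := by
  obtain ⟨Q, hQ⟩ := exists_resolvent hT (Or.inr rfl)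
  suffices star (resolventI hT) = Q by rw [this]; exact hQ
  refine ContinuousLinearMap.ext fun y => ext_inner_right ℂ fun x => ?_
  rw [ContinuousLinearMap.star_eq_adjoint, ContinuousLinearMap.adjoint_inner_left]
  obtain ⟨h, hy⟩ := hQ y
  have hx := apply_resolventI hT x
  have hsym := inner_symm_of_isSelfAdjoint hT ⟨Q y, h⟩ ⟨resolventI hT x, resolventI_mem hT x⟩
  conv_lhs => rw [← hy]
  conv_rhs => rw [← hx]
  rw [inner_add_left, inner_add_right, hsym, inner_smul_left, inner_smul_right]
  simp

theorem star_resolventI_apply (x : T.domain) :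
    star (resolventI hT) (T x + (-Complex.I) • (x : H)) = x := by
  obtain ⟨h, hw⟩ := star_resolventI hT (T x + (-Complex.I) • (x : H))
  exact congrArg Subtype.val ((existsUnique_add_smul_eq hT (Or.inr rfl) _).unique
    (y₁ := ⟨_, h⟩) hw rfl)

/-- Apply R to (T + i)R*x = x + 2iR*x. The companion identity has the factors in the other order;
comparing the two shows that R is normal. -/
theorem star_resolventI_sub :
    star (resolventI hT) - resolventI hT =
      (2 * Complex.I) • (resolventI hT * star (resolventI hT)) := by
  ext x
  obtain ⟨h, hx⟩ := star_resolventI hT x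
  have h1 := resolventI_apply hT ⟨_, h⟩
  have h2 : T ⟨star (resolventI hT) x, h⟩ + Complex.I • star (resolventI hT) x =
      x + (2 * Complex.I) • star (resolventI hT) x := by
    nth_rw 3 [← hx]; module
  dsimp only at h1
  rw [h2, _root_.map_add, _root_.map_smul] at h1
  rw [_root_.sub_apply, ← h1]
  simp

theorem star_resolventI_sub' :
    star (resolventI hT) - resolventI hT =
      (2 * Complex.I) • (star (resolventI hT) * resolventI hT) := by
  ext x
  have hx := apply_resolventI hT x
  have h1 := star_resolventI_apply hT ⟨_, resolventI_mem hT x⟩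
  have h2 : T ⟨resolventI hT x, resolventI_mem hT x⟩ + (-Complex.I) • resolventI hT x =
      x - (2 * Complex.I) • resolventI hT x := by
    refine Eq.trans ?_ (congrArg (· - (2 * Complex.I) • resolventI hT x) hx)
    module
  dsimp only at h1
  rw [h2, _root_.map_sub, _root_.map_smul] at h1
  rw [_root_.sub_apply, ← h1]
  simp

theorem isStarNormal_resolventI : IsStarNormal (resolventI hT) :=
  ⟨smul_right_injective _ (r := 2 * Complex.I) (by simp)
    ((star_resolventI_sub' hT).symm.trans (star_resolventI_sub hT))⟩

end Resolvent

end LinearPMap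

/-! ### From a representation of C(X) to scalar measures and L² functions -/

namespace ContinuousCalculus

open scoped InnerProductSpace ComplexConjugate ENNReal CompactlySupported Topology
open Filter

variable {X : Type*} [MetricSpace X] [CompactSpace X] [MeasurableSpace X] [BorelSpace X]
  {H : Type*} [NormedAddCommGroup H] [InnerProductSpace ℂ H] [CompleteSpace H]
  (π : C(X, ℂ) →⋆ₐ[ℂ] (H →L[ℂ] H))

/-- A real function as a complex function. -/
def ofRealMap (f : C(X, ℝ)) : C(X, ℂ) := ⟨fun x => (f x : ℂ), by fun_prop⟩

@[simp] theorem ofRealMap_apply (f : C(X, ℝ)) (x : X) : ofRealMap f x = (f x : ℂ) := rfl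

theorem inner_apply_left (f : C(X, ℂ)) (u v : H) : ⟪π f u, v⟫_ℂ = ⟪u, π (star f) v⟫_ℂ := by
  rw [map_star, ContinuousLinearMap.star_eq_adjoint, ContinuousLinearMap.adjoint_inner_right]

theorem inner_star_mul_self (f : C(X, ℂ)) (u : H) :
    ⟪u, π (star f * f) u⟫_ℂ = ((‖π f u‖ ^ 2 : ℝ) : ℂ) := by
  have h : π (star f * f) u = π (star f) (π f u) := by rw [map_mul]; rfl
  rw [h, ← inner_apply_left, inner_self_eq_norm_sq_to_K]
  norm_cast

theorem inner_ofRealMap (f : C(X, ℝ)) (u : H) :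
    (⟪u, π (ofRealMap f) u⟫_ℂ).im = 0 := by
  have h : star (ofRealMap f) = ofRealMap f := by ext x; simp
  rw [← Complex.conj_eq_iff_im, inner_conj_symm, inner_apply_left, h]

/-- The positive functional `f ↦ ⟨π(f)u, u⟩`. -/
def positiveFunctional (u : H) : C_c(X, ℝ) →ₚ[ℝ] ℝ :=
  PositiveLinearMap.mk₀
    { toFun := fun f => (⟪u, π (ofRealMap f.toContinuousMap) u⟫_ℂ).re
      map_add' := fun f g => by
        have : ofRealMap (f + g).toContinuousMap =
          ofRealMap f.toContinuousMap + ofRealMap g.toContinuousMap := by ext x; simp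
        rw [this, map_add, _root_.add_apply, inner_add_right, Complex.add_re]
      map_smul' := fun c f => by
        have : ofRealMap (c • f).toContinuousMap = (c : ℂ) • ofRealMap f.toContinuousMap := by
          ext x; simp
        rw [this, map_smul, _root_.smul_apply, inner_smul_right]
        simp }
    (fun f hf => by
      let g : C(X, ℂ) := ofRealMap ⟨fun x => √(f x), by fun_prop⟩
      have hg : ofRealMap f.toContinuousMap = star g * g := by
        ext x
        simp only [g, ofRealMap_apply, ContinuousMap.mul_apply, ContinuousMap.star_apply,
          ContinuousMap.coe_mk, RCLike.star_def, Complex.conj_ofReal]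
        rw [← Complex.ofReal_mul, Real.mul_self_sqrt (hf x)]
        rfl
      change 0 ≤ (⟪u, π (ofRealMap f.toContinuousMap) u⟫_ℂ).re
      rw [hg, inner_star_mul_self, Complex.ofReal_re]
      positivity)

/-- The measure `M` on `X` with `∫ f dM = ⟨π(f)u, u⟩`. -/
def scalarMeasure (u : H) : Measure X := RealRMK.rieszMeasure (positiveFunctional π u)

instance (u : H) : IsFiniteMeasure (scalarMeasure π u) := by
  unfold scalarMeasure; infer_instance

theorem integrable_continuousMap {E : Type*} [NormedAddCommGroup E]
    [SecondCountableTopology E] (μ : Measure X)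
    [IsFiniteMeasure μ] (f : C(X, E)) : Integrable f μ :=
  f.continuous.integrable_of_hasCompactSupport (HasCompactSupport.of_compactSpace f)

theorem integral_scalarMeasure_real (f : C(X, ℝ)) (u : H) :
    ∫ x, f x ∂(scalarMeasure π u) = (⟪u, π (ofRealMap f) u⟫_ℂ).re :=
  RealRMK.integral_rieszMeasure (positiveFunctional π u)
    ⟨f, HasCompactSupport.of_compactSpace f⟩

theorem integral_scalarMeasure (f : C(X, ℂ)) (u : H) :
    ∫ x, f x ∂(scalarMeasure π u) = ⟪u, π f u⟫_ℂ := by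
  let f₁ : C(X, ℝ) := ⟨fun x => (f x).re, by fun_prop⟩
  let f₂ : C(X, ℝ) := ⟨fun x => (f x).im, by fun_prop⟩
  have hf : f = ofRealMap f₁ + Complex.I • ofRealMap f₂ := by
    ext x
    simp only [ContinuousMap.add_apply, ContinuousMap.smul_apply, ofRealMap_apply, f₁, f₂,
      ContinuousMap.coe_mk, smul_eq_mul]
    rw [mul_comm, Complex.re_add_im]
  have key (g : C(X, ℝ)) : ∫ x, ofRealMap g x ∂(scalarMeasure π u) = ⟪u, π (ofRealMap g) u⟫_ℂ := by
    simp only [ofRealMap_apply]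
    rw [integral_complex_ofReal, integral_scalarMeasure_real]
    apply Complex.ext <;> simp [inner_ofRealMap]
  rw [hf]
  simp only [ContinuousMap.add_apply, ContinuousMap.smul_apply, map_add, map_smul,
    _root_.add_apply, _root_.smul_apply, inner_add_right,
    inner_smul_right]
  refine (integral_add (integrable_continuousMap _ (ofRealMap f₁))
    ((integrable_continuousMap _ (ofRealMap f₂)).smul Complex.I)).trans ?_
  rw [key, ← key f₂]
  exact congrArg _ (integral_smul Complex.I _)

/-- Both squares equal ⟨π(f*f)u, u⟩ = ∫ |f|² dM. Hence f ↦ π(f)u extends to an isometry on L²(M). -/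
theorem norm_toLp (f : C(X, ℂ)) (u : H) :
    ‖ContinuousMap.toLp 2 (scalarMeasure π u) ℂ f‖ = ‖π f u‖ := by
  rw [← sq_eq_sq₀ (norm_nonneg _) (norm_nonneg _), ← Complex.ofReal_inj,
    ← inner_star_mul_self, ← integral_scalarMeasure]
  have h := ContinuousMap.inner_toLp (𝕜 := ℂ) (scalarMeasure π u) f f
  rw [inner_self_eq_norm_sq_to_K] at h
  push_cast
  refine h.trans (integral_congr_ae (Eventually.of_forall fun x => ?_))
  simp [mul_comm]

/-- The linear map `f ↦ π(f)u`. -/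
def orbitMap (u : H) : C(X, ℂ) →ₗ[ℂ] H where
  toFun f := π f u
  map_add' f g := by rw [map_add]; rfl
  map_smul' c f := by rw [map_smul]; rfl

/-- The inclusion of the continuous functions into `L²(M)`. -/
def toLpMap (u : H) : C(X, ℂ) →ₗ[ℂ] Lp ℂ 2 (scalarMeasure π u) :=
  (ContinuousMap.toLp 2 (scalarMeasure π u) ℂ).toLinearMap

theorem denseRange_toLpMap (u : H) : DenseRange (toLpMap π u) :=
  ContinuousMap.toLp_denseRange ℂ (scalarMeasure π u) ℂ (by norm_num)

/-- The isometry `L²(M) → H` extending `f ↦ π(f)u`. -/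
def lpMap (u : H) : Lp ℂ 2 (scalarMeasure π u) →L[ℂ] H :=
  LinearMap.extendOfNorm (orbitMap π u) (toLpMap π u)

theorem lpMap_toLpMap (u : H) (f : C(X, ℂ)) : lpMap π u (toLpMap π u f) = π f u := by
  have h (f : C(X, ℂ)) : ‖orbitMap π u f‖ ≤ 1 * ‖toLpMap π u f‖ := by
    rw [one_mul]
    exact (norm_toLp π f u).ge
  exact LinearMap.extendOfNorm_eq (denseRange_toLpMap π u) ⟨1, h⟩ f

theorem norm_lpMap (u : H) (g : Lp ℂ 2 (scalarMeasure π u)) : ‖lpMap π u g‖ = ‖g‖ := by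
  refine (denseRange_toLpMap π u).induction_on g
    (isClosed_eq (by fun_prop) (by fun_prop)) fun f => ?_
  rw [lpMap_toLpMap]
  exact (norm_toLp π f u).symm

open Classical in
/-- The vector `g(N)u` for `g` square integrable (and `0` otherwise). -/
def apply (u : H) (g : X → ℂ) : H :=
  if hg : MemLp g 2 (scalarMeasure π u) then lpMap π u hg.toLp else 0

variable {π} {u v w : H} {g g' : X → ℂ}

theorem apply_of_memLp (hg : MemLp g 2 (scalarMeasure π u)) :
    apply π u g = lpMap π u hg.toLp := dif_pos hg

theorem memLp_continuousMap {μ : Measure X} [IsFiniteMeasure μ] (f : C(X, ℂ)) : MemLp f 2 μ :=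
  MemLp.of_bound (f.continuous.aestronglyMeasurable) ‖f‖
    (Eventually.of_forall fun x => f.norm_coe_le_norm x)

theorem apply_continuousMap (f : C(X, ℂ)) : apply π u f = π f u := by
  rw [apply_of_memLp (memLp_continuousMap f), ← lpMap_toLpMap]
  rfl

theorem apply_congr (h : g =ᵐ[scalarMeasure π u] g') : apply π u g = apply π u g' := by
  by_cases hg : MemLp g 2 (scalarMeasure π u)
  · rw [apply_of_memLp hg, apply_of_memLp (hg.ae_eq h)]
    congr 1
    exact MemLp.toLp_congr hg _ h
  · rw [apply, apply, dif_neg hg, dif_neg fun hg' => hg (hg'.ae_eq h.symm)]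

theorem apply_add (hg : MemLp g 2 (scalarMeasure π u)) (hg' : MemLp g' 2 (scalarMeasure π u)) :
    apply π u (g + g') = apply π u g + apply π u g' := by
  rw [apply_of_memLp hg, apply_of_memLp hg', apply_of_memLp (hg.add hg'), ← map_add]
  rfl

theorem tendsto_apply {f : ℕ → X → ℂ} (hf : ∀ n, MemLp (f n) 2 (scalarMeasure π u))
    (hg : MemLp g 2 (scalarMeasure π u))
    (h : Tendsto (fun n => eLpNorm (f n - g) 2 (scalarMeasure π u)) atTop (𝓝 0)) :
    Tendsto (fun n => apply π u (f n)) atTop (𝓝 (apply π u g)) := by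
  simp only [fun n => apply_of_memLp (hf n), apply_of_memLp hg]
  refine ((lpMap π u).continuous.tendsto _).comp ?_
  exact (Lp.tendsto_Lp_iff_tendsto_eLpNorm'' f hf g hg).2 h

theorem enorm_apply (hg : MemLp g 2 (scalarMeasure π u)) :
    ‖apply π u g‖ₑ = eLpNorm g 2 (scalarMeasure π u) := by
  rw [apply_of_memLp hg, ← ofReal_norm, norm_lpMap, Lp.norm_toLp, ENNReal.ofReal_toReal hg.2.ne]

/-- The density of the complex measure `A ↦ ⟨E(A)u, v⟩` with respect to the scalar measure
of `u`. -/
def density (π : C(X, ℂ) →⋆ₐ[ℂ] (H →L[ℂ] H)) (u v : H) (x : X) : ℂ :=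
  conj (ContinuousLinearMap.adjoint (lpMap π u) v x)

theorem memLp_density : MemLp (density π u v) 2 (scalarMeasure π u) :=
  (Lp.memLp (ContinuousLinearMap.adjoint (lpMap π u) v)).star

/-- Moving the isometry `lpMap` to v by its adjoint yields an L² density, so the complex measures
need no polarization. -/
theorem inner_apply (hg : MemLp g 2 (scalarMeasure π u)) :
    ⟪v, apply π u g⟫_ℂ = ∫ x, g x * density π u v x ∂(scalarMeasure π u) := by
  rw [apply_of_memLp hg, ← ContinuousLinearMap.adjoint_inner_left, L2.inner_def]
  refine integral_congr_ae ?_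
  filter_upwards [hg.coeFn_toLp] with x hx
  rw [hx]
  rfl

theorem integrable_density : Integrable (density π u v) (scalarMeasure π u) :=
  memLp_density.integrable (by norm_num)

theorem integrable_mul_density (hg : MemLp g 2 (scalarMeasure π u)) :
    Integrable (fun x => g x * density π u v x) (scalarMeasure π u) :=
  hg.integrable_mul memLp_density

/-- Approximation of a square integrable function by continuous functions. -/
theorem exists_tendsto_continuousMap {μ : Measure X} [IsFiniteMeasure μ] (hg : MemLp g 2 μ) :
    ∃ f : ℕ → C(X, ℂ), Tendsto (fun n => eLpNorm (⇑(f n) - g) 2 μ) atTop (𝓝 0) := by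
  have h (n : ℕ) : ∃ f : C(X, ℂ), eLpNorm (⇑f - g) 2 μ ≤ ENNReal.ofReal (1 / (n + 1)) := by
    obtain ⟨f, hf, -⟩ := hg.exists_boundedContinuous_eLpNorm_sub_le (by norm_num)
      (ε := ENNReal.ofReal (1 / (n + 1))) (by simp; positivity)
    exact ⟨f.toContinuousMap, by rw [eLpNorm_sub_comm]; exact hf⟩
  choose f hf using h
  refine ⟨f, tendsto_of_tendsto_of_tendsto_of_le_of_le tendsto_const_nhds ?_
    (fun _ => zero_le) hf⟩
  rw [← ENNReal.ofReal_zero]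
  exact ENNReal.tendsto_ofReal tendsto_one_div_add_atTop_nhds_zero_nat

theorem tendsto_eLpNorm_mono {μ ν : Measure X} (h : μ ≤ ν) {f : ℕ → X → ℂ}
    (hf : Tendsto (fun n => eLpNorm (f n - g) 2 ν) atTop (𝓝 0)) :
    Tendsto (fun n => eLpNorm (f n - g) 2 μ) atTop (𝓝 0) :=
  tendsto_of_tendsto_of_tendsto_of_le_of_le tendsto_const_nhds hf (fun _ => zero_le)
    fun _ => eLpNorm_mono_measure _ h

theorem tendsto_eLpNorm_mul {μ : Measure X} {f : ℕ → X → ℂ}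
    (hf : Tendsto (fun n => eLpNorm (f n - g) 2 μ) atTop (𝓝 0)) {b : X → ℂ} {C : ℝ}
    (hb : ∀ x, ‖b x‖ ≤ C) :
    Tendsto (fun n => eLpNorm (b * f n - b * g) 2 μ) atTop (𝓝 0) := by
  have h (n : ℕ) : eLpNorm (b * f n - b * g) 2 μ ≤ ENNReal.ofReal C * eLpNorm (f n - g) 2 μ := by
    refine eLpNorm_le_mul_eLpNorm_of_ae_le_mul (Eventually.of_forall fun x => ?_) 2
    simp only [Pi.sub_apply, Pi.mul_apply, ← mul_sub, norm_mul]
    gcongr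
    exact hb x
  refine tendsto_of_tendsto_of_tendsto_of_le_of_le tendsto_const_nhds ?_ (fun _ => zero_le) h
  simpa using ENNReal.Tendsto.const_mul hf (Or.inr ENNReal.ofReal_ne_top)

theorem memLp_mul {μ : Measure X} {b : X → ℂ} (hbm : Measurable b) {C : ℝ}
    (hb : ∀ x, ‖b x‖ ≤ C) (hg : MemLp g 2 μ) : MemLp (b * g) 2 μ :=
  hg.of_le_mul (hbm.aestronglyMeasurable.mul hg.1) (c := C) (Eventually.of_forall fun x => by
    simp only [Pi.mul_apply, norm_mul]; gcongr; exact hb x)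

/-- For continuous g this is multiplicativity of π; continuous functions are dense in L² and
multiplication by f is bounded there. -/
theorem map_apply (f : C(X, ℂ)) (hg : MemLp g 2 (scalarMeasure π u)) :
    π f (apply π u g) = apply π u (f * g) := by
  obtain ⟨φ, hφ⟩ := exists_tendsto_continuousMap hg
  have h1 := ((π f).continuous.tendsto _).comp
    (tendsto_apply (fun n => memLp_continuousMap (φ n)) hg hφ)
  have h2 := tendsto_apply (π := π) (u := u) (f := fun n => ⇑(f * φ n))
    (fun n => memLp_continuousMap _)
    (memLp_mul f.continuous.measurable f.norm_coe_le_norm hg)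
    (tendsto_eLpNorm_mul hφ f.norm_coe_le_norm)
  refine tendsto_nhds_unique h1 (h2.congr fun n => ?_)
  rw [Function.comp_apply, apply_continuousMap, apply_continuousMap, map_mul]
  rfl

end ContinuousCalculus

/-! ### Bounded Borel functions and spectral projections -/

namespace ContinuousCalculus

open scoped InnerProductSpace ComplexConjugate ENNReal CompactlySupported Topology
open Filter

variable {X : Type*} [MetricSpace X] [CompactSpace X] [MeasurableSpace X] [BorelSpace X]
  {H : Type*} [NormedAddCommGroup H] [InnerProductSpace ℂ H] [CompleteSpace H]
  {π : C(X, ℂ) →⋆ₐ[ℂ] (H →L[ℂ] H)} {u v : H} {b g : X → ℂ} {C : ℝ}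

theorem memLp_of_bounded {μ : Measure X} [IsFiniteMeasure μ] (hbm : Measurable b)
    (hb : ∀ x, ‖b x‖ ≤ C) : MemLp b 2 μ :=
  MemLp.of_bound hbm.aestronglyMeasurable C (Eventually.of_forall hb)

/-- Simultaneous approximation of the vectors `b(N)u` by `φ(N)u` with `φ` continuous. -/
theorem exists_approx (π : C(X, ℂ) →⋆ₐ[ℂ] (H →L[ℂ] H)) (hbm : Measurable b)
    (hb : ∀ x, ‖b x‖ ≤ C) (ν : Measure X) [IsFiniteMeasure ν] :
    ∃ φ : ℕ → C(X, ℂ), Tendsto (fun n => eLpNorm (⇑(φ n) - b) 2 ν) atTop (𝓝 0) ∧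
      ∀ u, scalarMeasure π u ≤ ν → Tendsto (fun n => π (φ n) u) atTop (𝓝 (apply π u b)) := by
  obtain ⟨φ, hφ⟩ := exists_tendsto_continuousMap (memLp_of_bounded (μ := ν) hbm hb)
  refine ⟨φ, hφ, fun u hu => ?_⟩
  refine (tendsto_apply (fun n => memLp_continuousMap (φ n)) (memLp_of_bounded hbm hb)
    (tendsto_eLpNorm_mono hu hφ)).congr fun n => apply_continuousMap _

/-- Not formal, since each vector has its own space L²(M). One sequence of continuous functions
approximating b in L² of the sum of the three measures serves all vectors at once, and π(φ n) is
linear. -/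
theorem apply_vector_add (hbm : Measurable b) (hb : ∀ x, ‖b x‖ ≤ C) :
    apply π (u + v) b = apply π u b + apply π v b := by
  obtain ⟨φ, -, hφ⟩ := exists_approx π hbm hb
    (scalarMeasure π (u + v) + scalarMeasure π u + scalarMeasure π v)
  have h1 := hφ (u + v) ((Measure.le_add_right le_rfl).trans (Measure.le_add_right le_rfl))
  have h2 := hφ u ((Measure.le_add_left le_rfl).trans (Measure.le_add_right le_rfl))
  have h3 := hφ v (Measure.le_add_left le_rfl)
  exact tendsto_nhds_unique h1 ((h2.add h3).congr fun n => (map_add _ _ _).symm)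

theorem apply_vector_smul (hbm : Measurable b) (hb : ∀ x, ‖b x‖ ≤ C) (c : ℂ) :
    apply π (c • u) b = c • apply π u b := by
  obtain ⟨φ, -, hφ⟩ := exists_approx π hbm hb (scalarMeasure π (c • u) + scalarMeasure π u)
  have h1 := hφ (c • u) (Measure.le_add_right le_rfl)
  have h2 := hφ u (Measure.le_add_left le_rfl)
  exact tendsto_nhds_unique h1 ((h2.const_smul c).congr fun n => (map_smul _ _ _).symm)

/-- The outer vector g(N)u has a different scalar measure from u, so b is approximated for the sum
of both; for continuous functions the claim is `map_apply`. -/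
theorem apply_apply (hbm : Measurable b) (hb : ∀ x, ‖b x‖ ≤ C) {C' : ℝ} (hgm : Measurable g)
    (hg : ∀ x, ‖g x‖ ≤ C') : apply π (apply π u g) b = apply π u (b * g) := by
  obtain ⟨φ, hφ, hφ'⟩ := exists_approx π hbm hb
    (scalarMeasure π u + scalarMeasure π (apply π u g))
  have h1 := hφ' (apply π u g) (Measure.le_add_left le_rfl)
  have hg2 : MemLp g 2 (scalarMeasure π u) := memLp_of_bounded hgm hg
  have h2 := tendsto_apply (π := π) (u := u) (f := fun n => g * φ n) (g := g * b)
    (fun n => memLp_mul hgm hg (memLp_continuousMap (φ n)))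
    (memLp_mul hgm hg (memLp_of_bounded hbm hb))
    (tendsto_eLpNorm_mul (tendsto_eLpNorm_mono (Measure.le_add_right le_rfl) hφ) hg)
  rw [mul_comm b g]
  refine tendsto_nhds_unique h1 (h2.congr fun n => ?_)
  rw [map_apply _ hg2, mul_comm]

theorem inner_apply_star (hbm : Measurable b) (hb : ∀ x, ‖b x‖ ≤ C) :
    ⟪apply π u b, v⟫_ℂ = ⟪u, apply π v (star b)⟫_ℂ := by
  obtain ⟨φ, hφ, hφ'⟩ := exists_approx π hbm hb (scalarMeasure π u + scalarMeasure π v)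
  have h1 := hφ' u (Measure.le_add_right le_rfl)
  have h2 := tendsto_apply (π := π) (u := v) (f := fun n => ⇑(star (φ n))) (g := star b)
    (fun n => memLp_continuousMap _)
    (memLp_of_bounded (C := C) (RCLike.continuous_conj.measurable.comp hbm) (by simpa using hb))
    ((tendsto_eLpNorm_mono (Measure.le_add_left le_rfl) hφ).congr fun n => by
      refine eLpNorm_congr_norm_ae (Eventually.of_forall fun x => ?_)
      have : (⇑(star (φ n)) - star b) x = conj ((⇑(φ n) - b) x) := by simp
      rw [this, RCLike.norm_conj])
  have h3 := (h1.inner (𝕜 := ℂ) (tendsto_const_nhds (x := v)))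
  have h4 := ((tendsto_const_nhds (x := u)).inner (𝕜 := ℂ) h2)
  refine tendsto_nhds_unique h3 (h4.congr fun n => ?_)
  rw [apply_continuousMap, inner_apply_left]

theorem norm_apply_le (hbm : Measurable b) (hb : ∀ x, ‖b x‖ ≤ 1) : ‖apply π u b‖ ≤ ‖u‖ := by
  have h1 := enorm_apply (π := π) (u := u) (memLp_of_bounded hbm hb)
  have h2 := enorm_apply (π := π) (u := u) (memLp_continuousMap 1)
  rw [apply_continuousMap, map_one, _root_.one_apply_eq_self] at h2
  rw [← enorm_le_iff_norm_le, h1, h2]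
  exact eLpNorm_mono fun x => by simpa using hb x

/-- The spectral projection of a set. -/
def projection (π : C(X, ℂ) →⋆ₐ[ℂ] (H →L[ℂ] H)) {B : Set X} (hB : MeasurableSet B) :
    H →L[ℂ] H :=
  LinearMap.mkContinuous
    { toFun := fun u => apply π u (B.indicator 1)
      map_add' := fun u v => apply_vector_add (C := 1) (measurable_one.indicator hB) fun x => by
        by_cases hx : x ∈ B <;> simp [hx]
      map_smul' := fun c u => apply_vector_smul (C := 1) (measurable_one.indicator hB) (fun x => by
        by_cases hx : x ∈ B <;> simp [hx]) c } 1
    fun u => by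
      rw [one_mul]
      exact norm_apply_le (measurable_one.indicator hB) fun x => by
        by_cases hx : x ∈ B <;> simp [hx]

section Projection

variable {A B : Set X} (hA : MeasurableSet A) (hB : MeasurableSet B)

theorem norm_indicator_one_le (B : Set X) (x : X) : ‖B.indicator (1 : X → ℂ) x‖ ≤ 1 := by
  by_cases hx : x ∈ B <;> simp [hx]

include hB in
theorem measurable_indicator_one : Measurable (B.indicator (1 : X → ℂ)) :=
  measurable_one.indicator hB

include hB in
theorem memLp_indicator_one {μ : Measure X} [IsFiniteMeasure μ] :
    MemLp (B.indicator (1 : X → ℂ)) 2 μ :=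
  memLp_of_bounded (measurable_indicator_one hB) (norm_indicator_one_le B)

theorem projection_apply : projection π hB u = apply π u (B.indicator 1) := rfl

theorem projection_mul :
    projection π hA * projection π hB = projection π (hA.inter hB) := by
  ext u
  refine (apply_apply (measurable_indicator_one hA) (norm_indicator_one_le A)
    (measurable_indicator_one hB) (norm_indicator_one_le B)).trans ?_
  rw [projection_apply, Set.inter_indicator_one]

theorem isStarProjection_projection : IsStarProjection (projection π hB) where
  isIdempotentElem := by
    rw [IsIdempotentElem, projection_mul]
    congr 1
    ext
    simp
  isSelfAdjoint := by
    rw [ContinuousLinearMap.isSelfAdjoint_iff_isSymmetric]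
    intro u v
    refine (inner_apply_star (measurable_indicator_one hB) (norm_indicator_one_le B)).trans ?_
    have : star (B.indicator (1 : X → ℂ)) = B.indicator 1 := by
      ext x
      by_cases hx : x ∈ B <;> simp [hx]
    rw [this]
    rfl

theorem inner_projection :
    ⟪v, projection π hB u⟫_ℂ = ∫ x in B, density π u v x ∂(scalarMeasure π u) := by
  rw [projection_apply, inner_apply (memLp_indicator_one hB), ← integral_indicator hB]
  congr 1 with x
  by_cases hx : x ∈ B <;> simp [hx]

/-- `lpMap` is isometric, so the left side is the squared L² norm of an indicator. -/
theorem enorm_projection_sq : ‖projection π hB u‖ₑ ^ 2 = scalarMeasure π u B := by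
  rw [projection_apply, enorm_apply (memLp_indicator_one hB)]
  have : (B.indicator (1 : X → ℂ)) = B.indicator fun _ => 1 := rfl
  rw [this, eLpNorm_indicator_const hB (by norm_num) (by norm_num)]
  simp only [enorm_one, one_mul, ENNReal.toReal_ofNat]
  rw [← ENNReal.rpow_natCast, ← ENNReal.rpow_mul]
  norm_num

theorem projection_union (h : Disjoint A B) :
    projection π (hA.union hB) = projection π hA + projection π hB := by
  ext u
  rw [_root_.add_apply, projection_apply, projection_apply, projection_apply,
    ← apply_add (memLp_indicator_one hA) (memLp_indicator_one hB),
    Set.indicator_union_of_disjoint h]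
  rfl

end Projection

variable {τ : X → ℝ}

open Classical in
/-- The resolution of the identity on `ℝ` obtained by transporting the spectral projections
along a measurable function. -/
def resolution (π : C(X, ℂ) →⋆ₐ[ℂ] (H →L[ℂ] H)) (hτ : Measurable τ) : ResolutionOfIdentity H where
  proj A := if hA : MeasurableSet A then projection π (hτ hA) else 0
  isStarProjection A hA := by rw [dif_pos hA]; exact isStarProjection_projection _
  inter A B hA hB := by
    rw [dif_pos hA, dif_pos hB, dif_pos (hA.inter hB), projection_mul]
    rfl
  empty := by
    rw [dif_pos MeasurableSet.empty]
    ext u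
    change projection π _ u = 0
    rw [← enorm_eq_zero, ← pow_eq_zero_iff (two_ne_zero), enorm_projection_sq]
    simp
  univ := by
    rw [dif_pos MeasurableSet.univ]
    ext u
    rw [projection_apply]
    have : (τ ⁻¹' Set.univ).indicator (1 : X → ℂ) = ⇑(1 : C(X, ℂ)) := by ext x; simp
    rw [this, apply_continuousMap, map_one]
  union A B hA hB h := by
    rw [dif_pos hA, dif_pos hB, dif_pos (hA.union hB),
      ← projection_union _ _ (h.preimage τ)]
    rfl
  hasSum u v A hA hd := by
    rw [dif_pos (MeasurableSet.iUnion hA)]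
    have h (n : ℕ) : (if hA : MeasurableSet (A n) then projection π (hτ hA) else 0) =
      projection π (hτ (hA n)) := dif_pos (hA n)
    simp only [h, inner_projection, Set.preimage_iUnion]
    exact hasSum_integral_iUnion (fun n => hτ (hA n)) (fun i j hij => (hd hij).preimage τ)
      integrable_density.integrableOn
  not_measurable A hA := dif_neg hA

theorem resolution_proj (hτ : Measurable τ) {A : Set ℝ} (hA : MeasurableSet A) :
    (resolution π hτ).proj A = projection π (hτ hA) := dif_pos hA

theorem measure_resolution (hτ : Measurable τ) (u : H) :
    (resolution π hτ).measure u = (scalarMeasure π u).map τ := by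
  ext A hA
  rw [ResolutionOfIdentity.measure_apply _ _ hA, ResolutionOfIdentity.inner_proj_self _ _ hA,
    Measure.map_apply hτ hA, Complex.ofReal_re, resolution_proj hτ hA,
    ← enorm_projection_sq (hτ hA), ENNReal.ofReal_pow (norm_nonneg _), ofReal_norm]

theorem complexMeasure_resolution (hτ : Measurable τ) (u v : H) :
    (resolution π hτ).complexMeasure u v =
      ((scalarMeasure π u).withDensityᵥ (density π u v)).map τ := by
  ext A hA
  rw [VectorMeasure.map_apply _ hτ hA, withDensityᵥ_apply integrable_density (hτ hA),
    ← inner_projection (hτ hA), ← resolution_proj hτ hA]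
  rfl

theorem resolution_integral (hτ : Measurable τ) {u : H}
    (h : MemLp (fun x => (τ x : ℂ)) 2 (scalarMeasure π u)) (v : H) :
    ((resolution π hτ).complexMeasure u v).Integrable (fun t : ℝ => t) ∧
    ⟪v, apply π u fun x => (τ x : ℂ)⟫_ℂ = ((resolution π hτ).complexMeasure u v).integral
      (fun t : ℝ => t) (ContinuousLinearMap.lsmul ℝ ℝ) := by
  -- Both τ and the density are square integrable, so their product is integrable.
  have hi : ((scalarMeasure π u).withDensityᵥ (density π u v)).Integrable τ := by
    rw [Measure.integrable_withDensityᵥ_iff integrable_density hτ]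
    simpa using integrable_mul_density h
  rw [complexMeasure_resolution]
  refine ⟨VectorMeasure.Integrable.map measurable_id.aestronglyMeasurable hi, ?_⟩
  rw [VectorMeasure.integral_map (f := fun t : ℝ => t) hτ measurable_id.aestronglyMeasurable hi,
    Measure.integral_withDensityᵥ integrable_density hi, inner_apply h]
  simp

/-- The scalar measures of a vector `π(f)u`. -/
theorem scalarMeasure_apply_map (f : C(X, ℂ)) (u : H) :
    scalarMeasure π (π f u) = (scalarMeasure π u).withDensity fun x => ‖f x‖ₑ ^ 2 := by
  ext B hB
  rw [← enorm_projection_sq hB, projection_apply, ← apply_continuousMap,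
    apply_apply (measurable_indicator_one hB) (norm_indicator_one_le B)
      f.continuous.measurable f.norm_coe_le_norm,
    enorm_apply (memLp_mul (measurable_indicator_one hB) (norm_indicator_one_le B)
      (memLp_continuousMap f)), withDensity_apply _ hB, ← lintegral_indicator hB]
  have h := eLpNorm_nnreal_pow_eq_lintegral (μ := scalarMeasure π u) (p := 2) (by norm_num)
    (f := B.indicator 1 * ⇑f)
  have h2 : ((2 : NNReal) : ℝ) = ((2 : ℕ) : ℝ) := by norm_num
  have h3 : ((2 : NNReal) : ℝ≥0∞) = 2 := by norm_num
  simp only [h2, ENNReal.rpow_natCast, h3] at h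
  rw [h]
  congr 1 with x
  by_cases hx : x ∈ B <;> simp [hx]

end ContinuousCalculus

/-! ### The spectral theorem for unbounded self-adjoint operators -/

namespace LinearPMap

open scoped InnerProductSpace ComplexConjugate ENNReal
open ContinuousCalculus Filter

variable {H : Type*} [NormedAddCommGroup H] [InnerProductSpace ℂ H] [CompleteSpace H]
  {T : H →ₗ.[ℂ] H} (hT : IsSelfAdjoint T)

/-- The continuous functional calculus of the resolvent. -/
def resolventCalculus : C(spectrum ℂ (resolventI hT), ℂ) →⋆ₐ[ℂ] (H →L[ℂ] H) :=
  cfcHom (isStarNormal_resolventI hT)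

/-- The coordinate on the spectrum of the resolvent. -/
def spectrumCoord : C(spectrum ℂ (resolventI hT), ℂ) :=
  (ContinuousMap.id ℂ).restrict (spectrum ℂ (resolventI hT))

theorem resolventCalculus_coord : resolventCalculus hT (spectrumCoord hT) = resolventI hT :=
  cfcHom_id _

theorem resolventI_eq_calculus (w : H) :
    resolventI hT w = resolventCalculus hT (spectrumCoord hT) w := by
  rw [resolventCalculus_coord]

/-- The functional calculus is injective, so R* - R = 2iR*R becomes a pointwise identity. It puts
the spectrum on the circle Im z = -|z|². -/
theorem spectrumCoord_relation (x : spectrum ℂ (resolventI hT)) :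
    conj (spectrumCoord hT x) - spectrumCoord hT x =
      2 * Complex.I * (conj (spectrumCoord hT x) * spectrumCoord hT x) := by
  have h : star (spectrumCoord hT) - spectrumCoord hT =
      (2 * Complex.I) • (star (spectrumCoord hT) * spectrumCoord hT) := by
    refine cfcHom_injective (isStarNormal_resolventI hT) ?_
    change resolventCalculus hT _ = resolventCalculus hT _
    rw [_root_.map_sub, _root_.map_smul, map_mul, map_star, resolventCalculus_coord,
      star_resolventI_sub']
  exact DFunLike.congr_fun h x

/-- The spectral parameter `t` with `z = 1 / (t + i)`. -/
def spectralParameter (x : spectrum ℂ (resolventI hT)) : ℝ := ((spectrumCoord hT x)⁻¹).re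

theorem measurable_spectralParameter : Measurable (spectralParameter hT) :=
  Complex.measurable_re.comp (spectrumCoord hT).continuous.measurable.inv

/-- On the circle Im z = -|z|² one has Im(1/z) = 1, so 1/z = t + i with t real. -/
theorem coord_mul_parameter {x : spectrum ℂ (resolventI hT)} (hx : spectrumCoord hT x ≠ 0) :
    spectrumCoord hT x * (spectralParameter hT x + Complex.I) = 1 := by
  have h := spectrumCoord_relation hT x
  rw [spectralParameter]
  generalize spectrumCoord hT x = z at h hx
  have him : z.im = -Complex.normSq z := by
    rw [mul_comm (conj z), Complex.mul_conj] at h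
    have := congrArg Complex.im h
    simp at this
    linarith
  have hn : Complex.normSq z ≠ 0 := by simpa using hx
  have : ((z⁻¹).re : ℂ) + Complex.I = z⁻¹ := by
    apply Complex.ext
    · simp
    · simp only [Complex.add_im, Complex.ofReal_im, Complex.I_im, zero_add, Complex.inv_im, him]
      field_simp
  rw [this, mul_inv_cancel₀ hx]

/-- The point z = 0 corresponds to t = ∞. The function z·1_{z = 0} vanishes, so R annihilates the
projection of u onto this point, and R is injective. -/
theorem ae_coord_ne_zero (u : H) :
    ∀ᵐ x ∂(scalarMeasure (resolventCalculus hT) u), spectrumCoord hT x ≠ 0 := by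
  let B : Set (spectrum ℂ (resolventI hT)) := spectrumCoord hT ⁻¹' {0}
  have hB : MeasurableSet B := (spectrumCoord hT).continuous.measurable (measurableSet_singleton 0)
  suffices scalarMeasure (resolventCalculus hT) u B = 0 by
    rw [ae_iff]; simpa [B, Set.preimage] using this
  have h : resolventI hT (projection (resolventCalculus hT) hB u) = 0 := by
    rw [resolventI_eq_calculus, projection_apply, map_apply _ (memLp_indicator_one hB)]
    have : (spectrumCoord hT) * B.indicator (1 : spectrum ℂ (resolventI hT) → ℂ) =
        ⇑(0 : C(spectrum ℂ (resolventI hT), ℂ)) := by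
      ext x
      by_cases hx : x ∈ B
      · simp [show spectrumCoord hT x = 0 from hx]
      · simp [hx]
    rw [this, apply_continuousMap, _root_.map_zero]
    rfl
  rw [← enorm_projection_sq hB, (resolventI_injective hT) (h.trans (_root_.map_zero _).symm)]
  simp

theorem ae_coord_mul_parameter (u : H) :
    ∀ᵐ x ∂(scalarMeasure (resolventCalculus hT) u),
      spectrumCoord hT x * (spectralParameter hT x + Complex.I) = 1 := by
  filter_upwards [ae_coord_ne_zero hT u] with x hx using coord_mul_parameter hT hx

/-- Since z(t + i) = 1 almost everywhere, R maps (t + i)(N)u to u. So u is in the range of R, and Tu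
= (t + i)(N)u - iu. -/
theorem mem_domain_of_memLp {u : H}
    (h : MemLp (fun x => (spectralParameter hT x : ℂ)) 2
      (scalarMeasure (resolventCalculus hT) u)) :
    ∃ hu : u ∈ T.domain, T ⟨u, hu⟩ =
      apply (resolventCalculus hT) u fun x => (spectralParameter hT x : ℂ) := by
  let c : C(spectrum ℂ (resolventI hT), ℂ) := Complex.I • 1
  have hadd := apply_add h (memLp_continuousMap c)
  rw [apply_continuousMap c] at hadd
  have hc : resolventCalculus hT c u = Complex.I • u := by
    simp [c]
  rw [hc] at hadd
  have hR : resolventI hT (apply (resolventCalculus hT) u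
      ((fun x => (spectralParameter hT x : ℂ)) + c)) = u := by
    have h1 := map_apply (spectrumCoord hT) (h.add (memLp_continuousMap c))
    rw [resolventCalculus_coord] at h1
    rw [h1, ContinuousCalculus.apply_congr (g' := ⇑(1 : C(spectrum ℂ (resolventI hT), ℂ))), apply_continuousMap,
      map_one, one_apply_eq_self]
    filter_upwards [ae_coord_mul_parameter hT u] with x hx
    simpa [c] using hx
  have hm := resolventI_mem hT (apply (resolventCalculus hT) u
      ((fun x => (spectralParameter hT x : ℂ)) + c))
  have ha := apply_resolventI hT (apply (resolventCalculus hT) u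
      ((fun x => (spectralParameter hT x : ℂ)) + c))
  have hu : u ∈ T.domain := hR ▸ hm
  refine ⟨hu, ?_⟩
  rw [LinearPMap.apply_congr (v := ⟨u, hu⟩) hR, hR, hadd] at ha
  exact add_right_cancel ha

/-- With w = Tu + iu one has u = Rw, so the scalar measure of u is |z|² times that of w. As |z|²t² ≤
|z|²|t + i|² = 1 off z = 0, the integral of t² is at most the finite total mass for w. -/
theorem memLp_of_mem_domain {u : H} (hu : u ∈ T.domain) :
    MemLp (fun x => (spectralParameter hT x : ℂ)) 2
      (scalarMeasure (resolventCalculus hT) u) := by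
  have hm : AEStronglyMeasurable (fun x => (spectralParameter hT x : ℂ))
      (scalarMeasure (resolventCalculus hT) u) :=
    (Complex.measurable_ofReal.comp (measurable_spectralParameter hT)).aestronglyMeasurable
  rw [memLp_two_iff_integrable_sq_norm hm]
  refine ⟨(hm.norm.pow 2), ?_⟩
  set w : H := T ⟨u, hu⟩ + Complex.I • u
  have huw : u = resolventCalculus hT (spectrumCoord hT) w := by
    rw [resolventCalculus_coord]
    exact (resolventI_apply hT ⟨u, hu⟩).symm
  rw [huw, scalarMeasure_apply_map, HasFiniteIntegral, lintegral_withDensity_eq_lintegral_mul₀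
    (((spectrumCoord hT).continuous.measurable.enorm.pow_const 2).aemeasurable)]
  · refine lt_of_le_of_lt (lintegral_mono (g := fun _ => 1) fun x => ?_) (by simp)
    by_cases hx : spectrumCoord hT x = 0
    · simp [hx]
    · have h1 := congrArg (fun z => ‖z‖ ^ 2) (coord_mul_parameter hT hx)
      have h2 : ‖(spectralParameter hT x : ℂ)‖ ^ 2 ≤
          ‖(spectralParameter hT x : ℂ) + Complex.I‖ ^ 2 := by
        rw [← Complex.normSq_eq_norm_sq, ← Complex.normSq_eq_norm_sq]
        simp [Complex.normSq_apply]
      simp only [norm_mul, mul_pow, norm_one, one_pow] at h1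
      have h3 : ‖spectrumCoord hT x‖ ^ 2 * ‖(spectralParameter hT x : ℂ)‖ ^ 2 ≤ 1 := by
        rw [← h1]; gcongr
      simp only [Pi.mul_apply, enorm_pow, enorm_norm]
      rw [← mul_pow, ← enorm_mul, ← ofReal_norm, ← ENNReal.ofReal_pow (norm_nonneg _), norm_mul,
        mul_pow]
      exact ENNReal.ofReal_le_one.2 h3
  · exact (((Complex.measurable_ofReal.comp
      (measurable_spectralParameter hT)).norm.pow_const 2).enorm).aemeasurable

/-- The spectral theorem for an unbounded self-adjoint operator: existence of a spectral
decomposition. -/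
theorem exists_isSpectralDecomposition (hT : IsSelfAdjoint T) :
    ∃ E : ResolutionOfIdentity H, IsSpectralDecomposition T E := by
  have hτ := measurable_spectralParameter hT
  refine ⟨resolution (resolventCalculus hT) hτ, fun u => ?_, fun u v => ?_⟩
  · have hm : AEStronglyMeasurable (fun x => (spectralParameter hT x : ℂ))
        (scalarMeasure (resolventCalculus hT) u) :=
      (Complex.measurable_ofReal.comp hτ).aestronglyMeasurable
    rw [measure_resolution, integrable_map_measure (by fun_prop) hτ.aemeasurable]
    have h : MemLp (fun x => (spectralParameter hT x : ℂ)) 2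
        (scalarMeasure (resolventCalculus hT) u) ↔
        Integrable ((fun t : ℝ => t ^ 2) ∘ spectralParameter hT)
          (scalarMeasure (resolventCalculus hT) u) := by
      rw [memLp_two_iff_integrable_sq_norm hm]
      simp [Function.comp_def]
    rw [← h]
    exact ⟨memLp_of_mem_domain hT, fun h => (mem_domain_of_memLp hT h).1⟩
  · have h := memLp_of_mem_domain hT u.2
    rw [show T u = _ from (mem_domain_of_memLp hT h).2]
    exact resolution_integral hτ h v

end LinearPMap

/-! ### Densities of the complex measures of a resolution of the identity -/

namespace ResolutionOfIdentity

open scoped InnerProductSpace ComplexConjugate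

variable {H : Type*} [NormedAddCommGroup H] [InnerProductSpace ℂ H] [CompleteSpace H]
  {E : ResolutionOfIdentity H} {μ : Measure ℝ} {u u' v : H} {d d' : ℝ → ℂ}

instance (u : H) : IsFiniteMeasure (E.measure u) :=
  ⟨by rw [E.measure_apply u MeasurableSet.univ]; exact ENNReal.ofReal_lt_top⟩

theorem complexMeasure_apply (A : Set ℝ) : E.complexMeasure u v A = ⟪v, E.proj A u⟫_ℂ := rfl

theorem inner_proj_left {A : Set ℝ} (hA : MeasurableSet A) :
    ⟪E.proj A u, v⟫_ℂ = ⟪u, E.proj A v⟫_ℂ := by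
  rw [← ContinuousLinearMap.adjoint_inner_right, ← ContinuousLinearMap.star_eq_adjoint,
    (E.isStarProjection A hA).isSelfAdjoint.star_eq]

/-- This localizes the weak identity for T: testing against E(A)v instead of v restricts the
integral to A. -/
theorem complexMeasure_restrict {A : Set ℝ} (hA : MeasurableSet A) :
    (E.complexMeasure u v).restrict A = E.complexMeasure u (E.proj A v) := by
  ext B hB
  rw [VectorMeasure.restrict_apply _ hA hB, complexMeasure_apply, complexMeasure_apply,
    inner_proj_left hA, Set.inter_comm, E.inter A B hA hB]
  rfl

/-- The complex measure `⟨E(·)u, v⟩` has density `d` with respect to `μ`. -/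
structure HasDensity (E : ResolutionOfIdentity H) (μ : Measure ℝ) (u v : H) (d : ℝ → ℂ) :
    Prop where
  integrable : Integrable d μ
  eq : E.complexMeasure u v = μ.withDensityᵥ d

theorem hasDensity_self : E.HasDensity (E.measure u) u u 1 := by
  have h : Integrable (1 : ℝ → ℂ) (E.measure u) := integrable_const 1
  refine ⟨h, ?_⟩
  ext A hA
  rw [withDensityᵥ_apply h hA, complexMeasure_apply, ← coe_measure_real _ _ hA]
  simp

namespace HasDensity

theorem add (h : E.HasDensity μ u v d) (h' : E.HasDensity μ u' v d') :
    E.HasDensity μ (u + u') v (d + d') := by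
  refine ⟨h.1.add h'.1, ?_⟩
  rw [withDensityᵥ_add h.1 h'.1, ← h.2, ← h'.2]
  ext A hA
  simp [complexMeasure_apply]

theorem smul (h : E.HasDensity μ u v d) (c : ℂ) : E.HasDensity μ (c • u) v (c • d) := by
  refine ⟨h.1.smul c, ?_⟩
  rw [withDensityᵥ_smul, ← h.2]
  ext A hA
  simp [complexMeasure_apply]

theorem symm (h : E.HasDensity μ u v d) : E.HasDensity μ v u fun x => conj (d x) := by
  have hi : Integrable (fun x => conj (d x)) μ := by
    rw [← integrable_norm_iff (RCLike.continuous_conj.comp_aestronglyMeasurable h.1.1)]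
    simpa using h.1.norm
  refine ⟨hi, ?_⟩
  ext A hA
  rw [withDensityᵥ_apply hi hA, integral_conj, ← withDensityᵥ_apply h.1 hA, ← h.2,
    complexMeasure_apply, complexMeasure_apply, inner_conj_symm, inner_proj_left hA]

theorem inner_eq_integral (h : E.HasDensity μ u v d) : ⟪v, u⟫_ℂ = ∫ x, d x ∂μ := by
  have h1 := congrArg (fun m => m Set.univ) h.2
  simp only [complexMeasure_apply, E.univ, withDensityᵥ_apply h.1 MeasurableSet.univ,
    Measure.restrict_univ] at h1
  exact h1

/-- Applying the operator multiplies the densities by the spectral parameter. -/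
theorem apply {T : H →ₗ.[ℂ] H} (hE : IsSpectralDecomposition T E) {u : T.domain}
    (h : E.HasDensity μ u v d) : E.HasDensity μ (T u) v fun t => t * d t := by
  have hi : Integrable (fun t : ℝ => t * d t) μ := by
    have := (hE.2 u v).1
    rw [h.2, Measure.integrable_withDensityᵥ_iff h.1 measurable_id'] at this
    simpa using this
  refine ⟨hi, ?_⟩
  ext A hA
  -- Against E(A)v the spectral identity reads ⟨E(A)Tu, v⟩ = ∫_A t d(t) dμ.
  obtain ⟨h1, h2⟩ := hE.2 u (E.proj A v)
  rw [← complexMeasure_restrict hA, h.2, Measure.restrict_withDensityᵥ h.1 hA] at h1 h2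
  rw [Measure.integral_withDensityᵥ (h.1.indicator hA) h1, inner_proj_left hA] at h2
  rw [complexMeasure_apply, h2, withDensityᵥ_apply hi hA, ← integral_indicator hA]
  congr 1 with x
  by_cases hx : x ∈ A <;> simp [hx]

end HasDensity

end ResolutionOfIdentity

/-! ### Orthogonality of the polynomials -/

section Orthogonality

open ResolutionOfIdentity

variable {a b : ℕ → ℝ} {T : ℓ²(ℕ, ℂ) →ₗ.[ℂ] ℓ²(ℕ, ℂ)} {E : ResolutionOfIdentity ℓ²(ℕ, ℂ)}
  {μ : Measure ℝ} {v : ℓ²(ℕ, ℂ)} {d : ℝ → ℂ}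

/-- Invariance of D allows J to be iterated on e_0, which gives moments of every order. -/
theorem jacobiOperator_apply_mem_domain (u : (jacobiOperator a b).domain) :
    jacobiOperator a b u ∈ (jacobiOperator a b).domain := by
  have h : jacobiOperator a b u ∈ LinearMap.range
    ((Module.Basis.span orthonormal_jacobiBasis.linearIndependent).constr ℂ (jacobiImage a b)) :=
    ⟨u, rfl⟩
  rw [Module.Basis.constr_range] at h
  refine (Submodule.span_le.2 ?_ : _ ≤ (jacobiOperator a b).domain) h
  have hk (k : ℕ) (c : ℝ) : (c : ℂ) • jacobiBasis k ∈ (jacobiOperator a b).domain :=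
    Submodule.smul_mem _ _ (jacobiBasis_mem_domain a b k)
  rintro _ ⟨k, rfl⟩
  rcases k with _ | k
  · exact add_mem (hk _ _) (hk _ _)
  · exact add_mem (add_mem (hk _ _) (hk _ _)) (hk _ _)

theorem apply_jacobiBasis_of_le (hJ : jacobiOperator a b ≤ T) (k : ℕ) :
    T ⟨jacobiBasis k, hJ.1 (jacobiBasis_mem_domain a b k)⟩ = jacobiImage a b k := by
  rw [← jacobiOperator_apply_basis]
  exact (hJ.2 (x := ⟨jacobiBasis k, jacobiBasis_mem_domain a b k⟩) rfl).symm

/-- The measure form of e_n = p_n(T)e_0: solve the recurrence T e_k = J e_k for its highest vector;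
T multiplies the density by t, so the polynomial recurrence appears. -/
theorem hasDensity_jacobiBasis (ha : ∀ k, 0 < a k) (hJ : jacobiOperator a b ≤ T)
    (hE : IsSpectralDecomposition T E) (h0 : E.HasDensity μ (jacobiBasis 0) v d) (n : ℕ) :
    E.HasDensity μ (jacobiBasis n) v
      fun t => (((jacobiPolynomial a b n).eval t : ℝ) : ℂ) * d t := by
  have hne (k : ℕ) : (a k : ℂ) ≠ 0 := by exact_mod_cast (ha k).ne'
  have hT (k : ℕ) (d' : ℝ → ℂ) (h : E.HasDensity μ (jacobiBasis k) v d') :=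
    HasDensity.apply hE (u := ⟨jacobiBasis k, hJ.1 (jacobiBasis_mem_domain a b k)⟩) h
  simp only [apply_jacobiBasis_of_le hJ] at hT
  induction n using Nat.twoStepInduction with
  | zero => simpa [jacobiPolynomial] using h0
  | one =>
    have h := ((hT 0 d h0).add (h0.smul (-(b 0 : ℂ)))).smul (a 0 : ℂ)⁻¹
    convert h using 1
    · simp only [jacobiImage]
      rw [add_assoc, ← add_smul, add_neg_cancel, zero_smul, add_zero, inv_smul_smul₀ (hne 0)]
    · ext t
      simp [jacobiPolynomial]
      ring
  | more n h1 h2 =>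
    have h := (((hT (n + 1) _ h2).add (h2.smul (-(b (n + 1) : ℂ)))).add
      (h1.smul (-(a n : ℂ)))).smul (a (n + 1) : ℂ)⁻¹
    convert h using 1
    · simp only [jacobiImage]
      rw [eq_inv_smul_iff₀ (hne (n + 1))]
      module
    · ext t
      simp [jacobiPolynomial]
      ring

theorem isOrthogonalityMeasure_of_isSpectralDecomposition (ha : ∀ k, 0 < a k)
    (hJ : jacobiOperator a b ≤ T) (hE : IsSpectralDecomposition T E) :
    IsOrthogonalityMeasure (E.measure (jacobiBasis 0)) (jacobiPolynomial a b) := by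
  set μ := E.measure (jacobiBasis 0) with hμ
  have h0 : E.HasDensity μ (jacobiBasis 0) (jacobiBasis 0) 1 := hasDensity_self
  constructor
  · intro k
    -- The vector is u = J^k e_0.
    have h : ∃ u : (jacobiOperator a b).domain,
        E.HasDensity μ (u : ℓ²(ℕ, ℂ)) (jacobiBasis 0) fun t => (t : ℂ) ^ k := by
      induction k with
      | zero => exact ⟨⟨_, jacobiBasis_mem_domain a b 0⟩, by simp only [pow_zero]; exact h0⟩
      | succ k ih =>
        obtain ⟨u, hu⟩ := ih
        refine ⟨⟨_, jacobiOperator_apply_mem_domain u⟩, ?_⟩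
        have h := HasDensity.apply hE (u := ⟨u, hJ.1 u.2⟩) hu
        rw [← hJ.2 (x := u) rfl] at h
        simpa [pow_succ'] using h
    obtain ⟨u, hu⟩ := h
    refine hu.integrable.re.congr (Filter.Eventually.of_forall fun x => ?_)
    simp only [← Complex.ofReal_pow]
    exact Complex.ofReal_re _
  · intro m n
    -- After the swap, the basis recurrence can be run in the other argument too, giving the density
    -- p_n p_m for the pair e_n, e_m.
    have h1 := (hasDensity_jacobiBasis ha hJ hE h0 m).symm
    have h2 := (hasDensity_jacobiBasis ha hJ hE h1 n).inner_eq_integral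
    rw [orthonormal_iff_ite.1 orthonormal_jacobiBasis] at h2
    have h3 (x : ℝ) : (((jacobiPolynomial a b n).eval x : ℝ) : ℂ) *
        (starRingEnd ℂ) ((((jacobiPolynomial a b m).eval x : ℝ) : ℂ) * (1 : ℝ → ℂ) x) =
        (((jacobiPolynomial a b m).eval x * (jacobiPolynomial a b n).eval x : ℝ) : ℂ) := by
      simp [mul_comm]
    simp only [h3, integral_complex_ofReal] at h2
    apply Complex.ofReal_injective
    rw [← h2]
    split_ifs <;> simp

end Orthogonality

/-! ### Closures, adjoints and essential self-adjointness -/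

namespace LinearPMap

open scoped InnerProductSpace

variable {H : Type*} [NormedAddCommGroup H] [InnerProductSpace ℂ H] [CompleteSpace H]
  {S T : H →ₗ.[ℂ] H}

theorem adjoint_antitone (hS : Dense (S.domain : Set H)) (h : S ≤ T) : T.adjoint ≤ S.adjoint := by
  have hT : Dense (T.domain : Set H) := hS.mono h.1
  have key (v : T.adjoint.domain) := mem_adjoint_of_forall_inner hS (v := v) (w := T.adjoint v)
    fun x => by rw [h.2 (x := x) (y := ⟨x, h.1 x.2⟩) rfl, ← inner_adjoint_left hT]
  refine ⟨fun v hv => (key ⟨v, hv⟩).1, fun v w hvw => ?_⟩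
  rw [← (key v).2]
  exact apply_congr hvw

theorem closure_le_of_le (hT : T.IsClosed) (h : S ≤ T) : S.closure ≤ T := by
  have hS : S.IsClosable := hT.isClosable.leIsClosable h
  refine le_of_le_graph ?_
  rw [← hS.graph_closure_eq_closure_graph]
  exact Submodule.topologicalClosure_minimal _ (le_graph_of_le h) hT

/-- For fixed v, the relation defining S†v is a closed condition on the pair (x, Sx), so it passes
from the graph to its closure. -/
theorem adjoint_closure (hS : Dense (S.domain : Set H)) (hc : S.IsClosable) :
    S.closure.adjoint = S.adjoint := by
  refine le_antisymm (adjoint_antitone hS S.le_closure) ?_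
  have hd : Dense (S.closure.domain : Set H) := hS.mono S.le_closure.1
  have key (v : S.adjoint.domain) := mem_adjoint_of_forall_inner hd (v := v) (w := S.adjoint v)
    fun x => by
      have hx : ((x : H), S.closure x) ∈ S.graph.topologicalClosure := by
        rw [hc.graph_closure_eq_closure_graph]
        exact mem_graph _ x
      have hcl : _root_.IsClosed {p : H × H | ⟪S.adjoint v, p.1⟫_ℂ = ⟪(v : H), p.2⟫_ℂ} :=
        isClosed_eq (by fun_prop) (by fun_prop)
      refine closure_minimal ?_ hcl hx
      rintro ⟨y, z⟩ hy
      obtain ⟨y, rfl, rfl⟩ := (mem_graph_iff S).1 hy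
      exact inner_adjoint_left hS v y
  refine ⟨fun v hv => (key ⟨v, hv⟩).1, fun v w hvw => ?_⟩
  rw [← (key v).2]
  exact apply_congr hvw

/-- A densely defined symmetric operator with trivial deficiency spaces is essentially
self-adjoint, and its closure is its adjoint. -/
theorem isSelfAdjoint_closure (hS : Dense (S.domain : Set H)) (h : S ≤ S.adjoint)
    (hker : ∀ v : S.adjoint.domain, S.adjoint v = Complex.I • (v : H) → (v : H) = 0)
    (hker' : ∀ v : S.adjoint.domain, S.adjoint v = (-Complex.I) • (v : H) → (v : H) = 0) :
    IsSelfAdjoint S.closure ∧ S.closure = S.adjoint := by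
  have hc : S.IsClosable := (adjoint_isClosed hS).isClosable.leIsClosable h
  have hadj := adjoint_closure hS hc
  have hle : S.closure ≤ S.closure.adjoint := by
    rw [hadj]
    exact closure_le_of_le (adjoint_isClosed hS) h
  have := adjoint_eq_of_injective (hS.mono S.le_closure.1) hle hc.closure_isClosed
    (by rw [hadj]; exact hker) (by rw [hadj]; exact hker')
  exact ⟨this, by rw [← hadj, this]⟩

end LinearPMap

/-! ### The adjoint of the Jacobi operator -/

section Jacobi

open scoped InnerProductSpace ComplexConjugate Topology
open LinearPMap Filter

variable {a b : ℕ → ℝ}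

/-- The action of the Jacobi matrix on arbitrary sequences. -/
def jacobiMatrixApply (a b : ℕ → ℝ) (v : ℕ → ℂ) : ℕ → ℂ
  | 0 => a 0 * v 1 + b 0 * v 0
  | k + 1 => a (k + 1) * v (k + 2) + b (k + 1) * v (k + 1) + a k * v k

theorem inner_jacobiBasis (v : ℓ²(ℕ, ℂ)) (k : ℕ) : ⟪v, jacobiBasis k⟫_ℂ = conj (v k) := by
  simp [jacobiBasis, lp.inner_single_right]

theorem inner_jacobiImage (v : ℓ²(ℕ, ℂ)) (k : ℕ) :
    ⟪v, jacobiImage a b k⟫_ℂ = conj (jacobiMatrixApply a b v k) := by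
  rcases k with _ | k <;>
    simp [jacobiImage, jacobiMatrixApply, inner_jacobiBasis]

theorem dense_jacobiOperator_domain (a b : ℕ → ℝ) :
    Dense ((jacobiOperator a b).domain : Set ℓ²(ℕ, ℂ)) := by
  rw [Submodule.dense_iff_topologicalClosure_eq_top, Submodule.topologicalClosure_eq_top_iff,
    Submodule.eq_bot_iff]
  intro v hv
  ext k
  have := (Submodule.mem_orthogonal' _ v).1 hv _ (jacobiBasis_mem_domain a b k)
  rw [inner_jacobiBasis] at this
  simpa using this

theorem jacobiOperator_domain_ext {f g : (jacobiOperator a b).domain →ₗ[ℂ] ℂ}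
    (h : ∀ k, f ⟨jacobiBasis k, jacobiBasis_mem_domain a b k⟩ =
      g ⟨jacobiBasis k, jacobiBasis_mem_domain a b k⟩) : f = g := by
  refine (Module.Basis.span orthonormal_jacobiBasis.linearIndependent).ext fun k => ?_
  have hk : Module.Basis.span orthonormal_jacobiBasis.linearIndependent k =
      ⟨jacobiBasis k, Submodule.subset_span ⟨k, rfl⟩⟩ :=
    Subtype.ext (by simp [Module.Basis.span_apply])
  rw [hk]
  exact h k

/-- The adjoint of the Jacobi operator acts by the Jacobi matrix on its maximal domain. -/
theorem mem_jacobi_adjoint_iff {v w : ℓ²(ℕ, ℂ)} :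
    (∃ hv : v ∈ (jacobiOperator a b).adjoint.domain, (jacobiOperator a b).adjoint ⟨v, hv⟩ = w) ↔
      ∀ k, w k = jacobiMatrixApply a b v k := by
  have hd := dense_jacobiOperator_domain a b
  constructor
  · rintro ⟨hv, rfl⟩ k
    have := inner_adjoint_left hd ⟨v, hv⟩ ⟨jacobiBasis k, jacobiBasis_mem_domain a b k⟩
    rw [jacobiOperator_apply_basis, inner_jacobiImage, inner_jacobiBasis] at this
    exact (starRingEnd ℂ).injective this
  · intro h
    refine mem_adjoint_of_forall_inner hd fun x => ?_
    have : (innerₛₗ ℂ w).comp (jacobiOperator a b).domain.subtype =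
        (innerₛₗ ℂ v).comp (jacobiOperator a b).toFun := by
      refine jacobiOperator_domain_ext fun k => ?_
      change ⟪w, jacobiBasis k⟫_ℂ = ⟪v, jacobiOperator a b ⟨jacobiBasis k, _⟩⟫_ℂ
      rw [jacobiOperator_apply_basis, inner_jacobiImage, inner_jacobiBasis, h]
    exact LinearMap.congr_fun this x

theorem jacobi_adjoint_apply (v : (jacobiOperator a b).adjoint.domain) (k : ℕ) :
    (jacobiOperator a b).adjoint v k = jacobiMatrixApply a b (v : ℓ²(ℕ, ℂ)) k :=
  mem_jacobi_adjoint_iff.1 ⟨v.2, rfl⟩ k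

/-- Columns on the left, rows on the right: this is the symmetry of the Jacobi matrix. -/
theorem jacobiImage_apply (k j : ℕ) :
    jacobiImage a b k j = jacobiMatrixApply a b (jacobiBasis k) j := by
  rcases k with _ | k <;> rcases j with _ | j <;>
    simp only [jacobiImage, jacobiMatrixApply, jacobiBasis, lp.coeFn_add, lp.coeFn_smul,
      Pi.add_apply, Pi.smul_apply, lp.single_apply, Pi.single_apply, smul_eq_mul] <;>
    grind

theorem jacobiOperator_le_adjoint (a b : ℕ → ℝ) :
    jacobiOperator a b ≤ (jacobiOperator a b).adjoint := by
  have hd := dense_jacobiOperator_domain a b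
  have key (k : ℕ) := mem_jacobi_adjoint_iff (a := a) (b := b) (v := jacobiBasis k)
    (w := jacobiImage a b k) |>.2 (jacobiImage_apply k)
  refine IsFormalAdjoint.le_adjoint hd fun y x => ?_
  have : (innerₛₗ ℂ (jacobiOperator a b y)).comp (jacobiOperator a b).domain.subtype =
      (innerₛₗ ℂ (y : ℓ²(ℕ, ℂ))).comp (jacobiOperator a b).toFun := by
    refine jacobiOperator_domain_ext fun k => ?_
    change ⟪jacobiOperator a b y, jacobiBasis k⟫_ℂ =
      ⟪(y : ℓ²(ℕ, ℂ)), jacobiOperator a b ⟨jacobiBasis k, _⟩⟫_ℂ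
    obtain ⟨h, hk⟩ := key k
    have := inner_adjoint_left hd ⟨_, h⟩ y
    rw [hk] at this
    rw [jacobiOperator_apply_basis, ← inner_conj_symm, ← this, inner_conj_symm]
  exact LinearMap.congr_fun this x

/-! ### Deficiency spaces -/

theorem mem_deficiencySpace_iff {H : Type*} [NormedAddCommGroup H] [InnerProductSpace ℂ H]
    [CompleteSpace H] {T : H →ₗ.[ℂ] H} {z : ℂ} {v : H} : v ∈ deficiencySpace T z ↔
      ∃ hv : v ∈ T.adjoint.domain, T.adjoint ⟨v, hv⟩ = z • v := by
  simp only [deficiencySpace, Submodule.mem_map, LinearMap.mem_ker, LinearMap.sub_apply,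
    LinearMap.smul_apply, Submodule.subtype_apply, sub_eq_zero]
  constructor
  · rintro ⟨v, hv, rfl⟩
    exact ⟨v.2, hv⟩
  · rintro ⟨hv, h⟩
    exact ⟨⟨v, hv⟩, h, rfl⟩

theorem mem_deficiencySpace_jacobi_iff {z : ℂ} {v : ℓ²(ℕ, ℂ)} :
    v ∈ deficiencySpace (jacobiOperator a b) z ↔ ∀ k, z * v k = jacobiMatrixApply a b v k := by
  rw [mem_deficiencySpace_iff, mem_jacobi_adjoint_iff]
  simp

theorem jacobiMatrixApply_star (v : ℕ → ℂ) (k : ℕ) :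
    jacobiMatrixApply a b (star v) k = conj (jacobiMatrixApply a b v k) := by
  rcases k with _ | k <;> simp [jacobiMatrixApply]

/-- The matrix has real entries, so conjugation commutes with it. Applied to ±i, this makes the two
deficiency spaces vanish together. -/
theorem star_mem_deficiencySpace {z : ℂ} {v : ℓ²(ℕ, ℂ)}
    (hv : v ∈ deficiencySpace (jacobiOperator a b) z) :
    star v ∈ deficiencySpace (jacobiOperator a b) (conj z) := by
  rw [mem_deficiencySpace_jacobi_iff] at hv ⊢
  intro k
  rw [lp.coeFn_star, jacobiMatrixApply_star, ← hv k]
  simp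

/-- As a_k ≠ 0, the recurrence determines v(k + 1) from the earlier entries. Evaluation at 0
therefore embeds the deficiency space in ℂ. -/
theorem eq_zero_of_apply_zero (ha : ∀ k, 0 < a k) {z : ℂ} {v : ℓ²(ℕ, ℂ)}
    (hv : v ∈ deficiencySpace (jacobiOperator a b) z) (h0 : v 0 = 0) : v = 0 := by
  rw [mem_deficiencySpace_jacobi_iff] at hv
  have hne (k : ℕ) : (a k : ℂ) ≠ 0 := by exact_mod_cast (ha k).ne'
  ext k
  change v k = 0
  induction k using Nat.twoStepInduction with
  | zero => exact h0
  | one =>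
    have := hv 0
    simpa [jacobiMatrixApply, h0, hne] using this
  | more k h1 h2 =>
    have := hv (k + 1)
    simpa [jacobiMatrixApply, h1, h2, hne] using this

theorem rank_deficiencySpace_le_one (ha : ∀ k, 0 < a k) (z : ℂ) :
    Module.rank ℂ (deficiencySpace (jacobiOperator a b) z) ≤ 1 := by
  let f : deficiencySpace (jacobiOperator a b) z →ₗ[ℂ] ℂ :=
    { toFun := fun v => (v : ℓ²(ℕ, ℂ)) 0
      map_add' := fun v w => rfl
      map_smul' := fun c v => rfl }
  have hf : Function.Injective f := (injective_iff_map_eq_zero f).2 fun v hv =>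
    Subtype.ext (eq_zero_of_apply_zero ha v.2 hv)
  simpa using LinearMap.rank_le_of_injective f hf

theorem deficiencySpace_neg_I_eq_bot_iff :
    deficiencySpace (jacobiOperator a b) (-Complex.I) = ⊥ ↔
      deficiencySpace (jacobiOperator a b) Complex.I = ⊥ := by
  simp only [Submodule.eq_bot_iff]
  constructor <;> intro h v hv <;> refine star_eq_zero.1 (h _ ?_) <;>
    simpa using star_mem_deficiencySpace hv

theorem deficiencyIndices_jacobi (ha : ∀ k, 0 < a k) :
    deficiencyIndices (jacobiOperator a b) = (0, 0) ∨
      deficiencyIndices (jacobiOperator a b) = (1, 1) := by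
  have h1 (z : ℂ) (hz : deficiencySpace (jacobiOperator a b) z ≠ ⊥) :
      Module.rank ℂ (deficiencySpace (jacobiOperator a b) z) = 1 :=
    le_antisymm (rank_deficiencySpace_le_one ha z)
      (Cardinal.one_le_iff_ne_zero.2 fun h => hz (Submodule.rank_eq_zero.1 h))
  by_cases h : deficiencySpace (jacobiOperator a b) Complex.I = ⊥
  · left
    rw [deficiencyIndices, h, deficiencySpace_neg_I_eq_bot_iff.2 h, rank_bot]
  · right
    rw [deficiencyIndices, h1 _ h, h1 _ (deficiencySpace_neg_I_eq_bot_iff.not.2 h)]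

theorem jacobi_closure_of_deficiencyIndices
    (h : deficiencyIndices (jacobiOperator a b) = (0, 0)) :
    IsSelfAdjoint (jacobiOperator a b).closure ∧
      (jacobiOperator a b).closure = (jacobiOperator a b).adjoint := by
  have h1 := congrArg Prod.fst h
  have h2 := congrArg Prod.snd h
  simp only [deficiencyIndices, Submodule.rank_eq_zero, Submodule.eq_bot_iff] at h1 h2
  exact isSelfAdjoint_closure (dense_jacobiOperator_domain a b) (jacobiOperator_le_adjoint a b)
    (fun v hv => h1 _ (mem_deficiencySpace_iff.2 ⟨v.2, hv⟩))
    (fun v hv => h2 _ (mem_deficiencySpace_iff.2 ⟨v.2, hv⟩))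

/-! ### Self-adjoint extensions -/

/-- The Wronskian of two sequences. -/
def jacobiWronskian (a : ℕ → ℝ) (u v : ℕ → ℂ) (n : ℕ) : ℂ :=
  a n * (u (n + 1) * v n - u n * v (n + 1))

/-- The discrete Green formula: the diagonal terms cancel and the off-diagonal ones telescope. -/
theorem sum_jacobiMatrixApply (u v : ℕ → ℂ) (n : ℕ) :
    ∑ k ∈ Finset.range (n + 1), (jacobiMatrixApply a b u k * v k - u k * jacobiMatrixApply a b v k)
      = jacobiWronskian a u v n := by
  induction n with
  | zero => simp [jacobiMatrixApply, jacobiWronskian]; ring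
  | succ n ih => rw [Finset.sum_range_succ, ih]; simp [jacobiMatrixApply, jacobiWronskian]; ring

/-- Up to the factor a_n, the Wronskian is the determinant of two vectors in a plane (entries n and
n + 1), and four such vectors satisfy the Plücker relation. Being polynomial, it survives the limit
n → ∞. -/
theorem wronskian_pluecker (u v ψ χ : ℕ → ℂ) (n : ℕ) :
    jacobiWronskian a u v n * jacobiWronskian a ψ χ n =
      jacobiWronskian a u ψ n * jacobiWronskian a v χ n - jacobiWronskian a u χ n * jacobiWronskian a v ψ n := by
  simp only [jacobiWronskian]; ring

theorem inner_star_comm (u v : ℓ²(ℕ, ℂ)) : ⟪star u, v⟫_ℂ = ⟪star v, u⟫_ℂ := by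
  rw [lp.inner_eq_tsum, lp.inner_eq_tsum]
  congr 1 with k
  simp [mul_comm]

theorem inner_star_star (u v : ℓ²(ℕ, ℂ)) : ⟪star u, star v⟫_ℂ = ⟪v, u⟫_ℂ := by
  rw [inner_star_comm, star_star]

/-- The boundary form of the adjoint of the Jacobi operator, in a bilinear version. -/
def boundaryForm (u v : (jacobiOperator a b).adjoint.domain) : ℂ :=
  ⟪star (v : ℓ²(ℕ, ℂ)), (jacobiOperator a b).adjoint u⟫_ℂ -
    ⟪star ((jacobiOperator a b).adjoint v), (u : ℓ²(ℕ, ℂ))⟫_ℂ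

theorem tendsto_wronskian (u v : (jacobiOperator a b).adjoint.domain) :
    Tendsto (jacobiWronskian a (u : ℓ²(ℕ, ℂ)) (v : ℓ²(ℕ, ℂ))) atTop (𝓝 (boundaryForm u v)) := by
  have h1 := lp.hasSum_inner (𝕜 := ℂ) (star (v : ℓ²(ℕ, ℂ))) ((jacobiOperator a b).adjoint u)
  have h2 := lp.hasSum_inner (𝕜 := ℂ) (star ((jacobiOperator a b).adjoint v)) (u : ℓ²(ℕ, ℂ))
  -- The shift by one matches Green's formula, whose sum runs up to and including n.
  refine (((h1.sub h2).tendsto_sum_nat.comp (tendsto_add_atTop_nat 1))).congr fun n => ?_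
  rw [← sum_jacobiMatrixApply (b := b)]
  refine Finset.sum_congr rfl fun k _ => ?_
  simp [jacobi_adjoint_apply, mul_comm]

theorem boundaryForm_pluecker (u v ψ χ : (jacobiOperator a b).adjoint.domain) :
    boundaryForm u v * boundaryForm ψ χ =
      boundaryForm u ψ * boundaryForm v χ - boundaryForm u χ * boundaryForm v ψ := by
  refine tendsto_nhds_unique ((tendsto_wronskian u v).mul (tendsto_wronskian ψ χ)) ?_
  refine ((((tendsto_wronskian u ψ).mul (tendsto_wronskian v χ)).sub
    ((tendsto_wronskian u χ).mul (tendsto_wronskian v ψ)))).congr fun n => ?_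
  exact (wronskian_pluecker _ _ _ _ n).symm

theorem jacobi_adjoint_star (v : (jacobiOperator a b).adjoint.domain) :
    ∃ h : star (v : ℓ²(ℕ, ℂ)) ∈ (jacobiOperator a b).adjoint.domain,
      (jacobiOperator a b).adjoint ⟨_, h⟩ = star ((jacobiOperator a b).adjoint v) := by
  rw [mem_jacobi_adjoint_iff]
  intro k
  rw [lp.coeFn_star, lp.coeFn_star, jacobiMatrixApply_star, ← jacobi_adjoint_apply]
  rfl

/-- The restriction of the adjoint of the Jacobi operator by the boundary condition given by a
vector `ψ` of its domain. -/
def jacobiExtension (ψ : (jacobiOperator a b).adjoint.domain) : ℓ²(ℕ, ℂ) →ₗ.[ℂ] ℓ²(ℕ, ℂ) :=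
  (jacobiOperator a b).adjoint.domRestrict
    ((LinearMap.ker ((innerₛₗ ℂ (ψ : ℓ²(ℕ, ℂ))).comp (jacobiOperator a b).adjoint.toFun -
      (innerₛₗ ℂ ((jacobiOperator a b).adjoint ψ)).comp
        (jacobiOperator a b).adjoint.domain.subtype)).map
      (jacobiOperator a b).adjoint.domain.subtype)

section Extension

variable {ψ : (jacobiOperator a b).adjoint.domain}

theorem jacobiExtension_le (ψ : (jacobiOperator a b).adjoint.domain) :
    jacobiExtension ψ ≤ (jacobiOperator a b).adjoint := domRestrict_le

theorem mem_jacobiExtension_domain {u : (jacobiOperator a b).adjoint.domain} :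
    (u : ℓ²(ℕ, ℂ)) ∈ (jacobiExtension ψ).domain ↔
      ⟪(ψ : ℓ²(ℕ, ℂ)), (jacobiOperator a b).adjoint u⟫_ℂ =
        ⟪(jacobiOperator a b).adjoint ψ, (u : ℓ²(ℕ, ℂ))⟫_ℂ := by
  simp only [jacobiExtension, domRestrict_domain, Submodule.mem_inf, u.2, and_true,
    Submodule.mem_map, LinearMap.mem_ker, LinearMap.sub_apply, sub_eq_zero]
  constructor
  · rintro ⟨w, hw, h⟩
    rw [Subtype.ext h] at hw
    exact hw
  · intro h
    exact ⟨u, h, rfl⟩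

theorem le_jacobiExtension (ψ : (jacobiOperator a b).adjoint.domain) :
    jacobiOperator a b ≤ jacobiExtension ψ := by
  have hJ := jacobiOperator_le_adjoint a b
  have hle : (jacobiOperator a b).domain ≤ (jacobiExtension ψ).domain := fun x hx => by
    refine (mem_jacobiExtension_domain (u := ⟨x, hJ.1 hx⟩)).2 ?_
    rw [inner_adjoint_left (dense_jacobiOperator_domain a b) ψ ⟨x, hx⟩,
      hJ.2 (x := ⟨x, hx⟩) (y := ⟨x, hJ.1 hx⟩) rfl]
  refine ⟨hle, fun x y hxy => ?_⟩
  rw [hJ.2 (x := x) (y := ⟨x, hJ.1 x.2⟩) rfl,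
    (jacobiExtension_le ψ).2 (x := y) (y := ⟨x, hJ.1 x.2⟩) hxy.symm]

/-- As ψ is real, the boundary condition is B(u, ψ) = 0 and is stable under conjugation. If u and v
satisfy it, the Plücker relation gives B(u, v̄)B(ψ, χ) = 0, hence B(u, v̄) = 0, which is symmetry.
Conversely ψ satisfies its own condition, so testing a vector of the adjoint domain against ψ
returns the condition for that vector. -/
theorem isSelfAdjoint_jacobiExtension (hψ : star (ψ : ℓ²(ℕ, ℂ)) = ψ)
    (χ : (jacobiOperator a b).adjoint.domain) (hχ : boundaryForm ψ χ ≠ 0) :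
    IsSelfAdjoint (jacobiExtension ψ) := by
  have hJd := dense_jacobiOperator_domain a b
  have hd : Dense ((jacobiExtension ψ).domain : Set ℓ²(ℕ, ℂ)) :=
    hJd.mono (le_jacobiExtension ψ).1
  have hψ' : star ((jacobiOperator a b).adjoint ψ) = (jacobiOperator a b).adjoint ψ := by
    obtain ⟨h, h'⟩ := jacobi_adjoint_star ψ
    rw [← h']
    exact LinearPMap.apply_congr hψ
  have hmem (u : (jacobiOperator a b).adjoint.domain) :
      (u : ℓ²(ℕ, ℂ)) ∈ (jacobiExtension ψ).domain ↔ boundaryForm u ψ = 0 := by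
    rw [mem_jacobiExtension_domain, boundaryForm, hψ, hψ', sub_eq_zero]
  have hval (u : (jacobiExtension ψ).domain) : jacobiExtension ψ u =
      (jacobiOperator a b).adjoint ⟨u, (jacobiExtension_le ψ).1 u.2⟩ :=
    (jacobiExtension_le ψ).2 rfl
  have hsymm (u v : (jacobiExtension ψ).domain) :
      ⟪jacobiExtension ψ v, (u : ℓ²(ℕ, ℂ))⟫_ℂ = ⟪(v : ℓ²(ℕ, ℂ)), jacobiExtension ψ u⟫_ℂ := by
    set u' : (jacobiOperator a b).adjoint.domain := ⟨u, (jacobiExtension_le ψ).1 u.2⟩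
    set v' : (jacobiOperator a b).adjoint.domain := ⟨v, (jacobiExtension_le ψ).1 v.2⟩
    have hu : boundaryForm u' ψ = 0 := (hmem u').1 u.2
    have hv : boundaryForm v' ψ = 0 := (hmem v').1 v.2
    -- B is bilinear while symmetry is sesquilinear, so v enters through its conjugate.
    obtain ⟨hs, hs'⟩ := jacobi_adjoint_star v'
    have hsv : boundaryForm ⟨_, hs⟩ ψ = 0 := by
      have h2 : boundaryForm ⟨_, hs⟩ ψ = conj (boundaryForm v' ψ) := by
        rw [boundaryForm, boundaryForm, hs', _root_.map_sub, inner_conj_symm, inner_conj_symm,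
          inner_star_star, inner_star_star, hψ, hψ']
      rw [h2, hv, _root_.map_zero]
    have h := boundaryForm_pluecker u' ⟨_, hs⟩ ψ χ
    rw [hu, hsv, zero_mul, mul_zero, sub_zero, mul_eq_zero, or_iff_left hχ, boundaryForm, hs',
      star_star, star_star, sub_eq_zero] at h
    rw [hval, hval]
    exact h.symm
  refine isSelfAdjoint_def.2 (le_antisymm ?_ ?_)
  · have hle := adjoint_antitone hJd (le_jacobiExtension ψ)
    have key (v : (jacobiExtension ψ).adjoint.domain) :
        (v : ℓ²(ℕ, ℂ)) ∈ (jacobiExtension ψ).domain := by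
      refine (mem_jacobiExtension_domain (u := ⟨v, hle.1 v.2⟩)).2 ?_
      have hψm : (ψ : ℓ²(ℕ, ℂ)) ∈ (jacobiExtension ψ).domain := by
        rw [mem_jacobiExtension_domain]
        nth_rw 1 [← hψ]
        rw [inner_star_comm, hψ']
      have h := inner_adjoint_left hd v ⟨ψ, hψm⟩
      rw [hval, hle.2 (x := v) (y := ⟨v, hle.1 v.2⟩) rfl] at h
      rw [← inner_conj_symm, h, inner_conj_symm]
    refine ⟨fun v hv => key ⟨v, hv⟩, fun v w hvw => ?_⟩
    rw [hle.2 (x := v) (y := ⟨v, hle.1 v.2⟩) rfl,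
      (jacobiExtension_le ψ).2 (x := w) (y := ⟨v, hle.1 v.2⟩) hvw.symm]
  · exact IsFormalAdjoint.le_adjoint hd fun v u => hsymm u v

end Extension

/-- For φ ≠ 0 with J*φ = iφ, the vector ψ = φ + φ̄ is real, and χ = φ works: B(φ, φ) = 0 and B(φ̄,
φ) = -2i‖φ‖² ≠ 0. -/
theorem exists_selfAdjoint_extension
    (h : deficiencySpace (jacobiOperator a b) Complex.I ≠ ⊥) :
    ∃ T : ℓ²(ℕ, ℂ) →ₗ.[ℂ] ℓ²(ℕ, ℂ), IsSelfAdjoint T ∧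
      jacobiOperator a b ≤ T ∧ T ≤ (jacobiOperator a b).adjoint := by
  obtain ⟨φ, hφ, hφ0⟩ := Submodule.exists_mem_ne_zero_of_ne_bot h
  obtain ⟨h1, h1'⟩ := mem_deficiencySpace_iff.1 hφ
  obtain ⟨h2, h2'⟩ := mem_deficiencySpace_iff.1 (star_mem_deficiencySpace hφ)
  set φ₁ : (jacobiOperator a b).adjoint.domain := ⟨φ, h1⟩
  set φ₂ : (jacobiOperator a b).adjoint.domain := ⟨star φ, h2⟩
  refine ⟨jacobiExtension (φ₁ + φ₂), isSelfAdjoint_jacobiExtension ?_ φ₁ ?_,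
    le_jacobiExtension _, jacobiExtension_le _⟩
  · simp [φ₁, φ₂, add_comm]
  · have hn : ⟪star φ, star φ⟫_ℂ = ((‖φ‖ ^ 2 : ℝ) : ℂ) := by
      rw [inner_self_eq_norm_sq_to_K, norm_star]
      norm_cast
    have hval : boundaryForm (φ₁ + φ₂) φ₁ = -(2 * Complex.I) * ((‖φ‖ ^ 2 : ℝ) : ℂ) := by
      rw [boundaryForm, LinearPMap.map_add, h1', h2', Submodule.coe_add, star_smul]
      simp only [φ₁, φ₂, inner_add_right, inner_smul_right, inner_smul_left, hn,
        RCLike.star_def, Complex.conj_I, _root_.map_neg]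
      ring
    rw [hval]
    simpa using hφ0

end Jacobi

end

theorem proposition3p3 (a b : ℕ → ℝ) (ha : ∀ k, 0 < a k) :
    (deficiencyIndices (jacobiOperator a b) = (0, 0) ∨
      deficiencyIndices (jacobiOperator a b) = (1, 1)) ∧
    (deficiencyIndices (jacobiOperator a b) = (0, 0) →
      IsEssentiallySelfAdjoint (jacobiOperator a b) ∧
      (jacobiOperator a b).closure = (jacobiOperator a b).adjoint ∧
      (∃ E : ResolutionOfIdentity ℓ²(ℕ, ℂ),
        IsSpectralDecomposition (jacobiOperator a b).adjoint E) ∧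
      ∀ E : ResolutionOfIdentity ℓ²(ℕ, ℂ),
        IsSpectralDecomposition (jacobiOperator a b).adjoint E →
        IsOrthogonalityMeasure (E.measure (jacobiBasis 0)) (jacobiPolynomial a b)) ∧
    (deficiencyIndices (jacobiOperator a b) = (1, 1) →
      (∃ T : ℓ²(ℕ, ℂ) →ₗ.[ℂ] ℓ²(ℕ, ℂ), IsSelfAdjoint T ∧
        jacobiOperator a b ≤ T ∧ T ≤ (jacobiOperator a b).adjoint) ∧
      ∀ T : ℓ²(ℕ, ℂ) →ₗ.[ℂ] ℓ²(ℕ, ℂ), IsSelfAdjoint T →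
        jacobiOperator a b ≤ T → T ≤ (jacobiOperator a b).adjoint →
        (∃ E : ResolutionOfIdentity ℓ²(ℕ, ℂ), IsSpectralDecomposition T E) ∧
        ∀ E : ResolutionOfIdentity ℓ²(ℕ, ℂ), IsSpectralDecomposition T E →
          IsOrthogonalityMeasure (E.measure (jacobiBasis 0)) (jacobiPolynomial a b)) := by
  refine ⟨deficiencyIndices_jacobi ha, fun h => ?_, fun h => ⟨?_, fun T hT hJ _ => ?_⟩⟩
  · obtain ⟨h1, h2⟩ := jacobi_closure_of_deficiencyIndices h
    refine ⟨h1, h2, LinearPMap.exists_isSpectralDecomposition (h2 ▸ h1), fun E hE => ?_⟩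
    exact isOrthogonalityMeasure_of_isSpectralDecomposition ha (jacobiOperator_le_adjoint a b) hE
  · refine exists_selfAdjoint_extension fun h0 => ?_
    have h1 := congrArg Prod.fst h
    rw [deficiencyIndices, h0, rank_bot] at h1
    exact zero_ne_one h1
  · exact ⟨LinearPMap.exists_isSpectralDecomposition hT, fun E hE =>
      isOrthogonalityMeasure_of_isSpectralDecomposition ha hJ hE⟩
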